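/- Let $p$ be a prime, let $\mathcal F$ be a saturated fusion system over a finite $p$-group $S$, and let $\mathcal F^c$ be the set of $\mathcal F$-centric subgroups of $S$, i.e. of the $P\le S$ such that $C_S(Q)\le Q$ for each $Q$ that is $\mathcal F$-conjugate to $P$. Let $\mathcal X\subseteq\mathcal F^c$ be a nonempty family of subgroups that is closed under $\mathcal F$-conjugacy and overgroups. Let $\mathcal F^{\mathcal X}\subseteq\mathcal F$ be the full subcategory with object set $\mathcal X$, and let $\mathcal T^{\mathcal X}(S)$ be the category with object set $\mathcal X$ and morphism sets $T_S(P,Q)=\{g\in S: gPg^{-1}\le Q\}$. An *$\mathcal X$-linking system* associated to $\mathcal F$ is a category $\mathcal L$ with object set $\mathcal X$, together with functors $\pi\colon\mathcal L\to\mathcal F^{\mathcal X}$ and $\delta\colon\mathcal T^{\mathcal X}(S)\to\mathcal L$ that are the identity on objects, such that for all $P,Q\in\mathcal X$: (A) $\pi$ is surjective on morphisms, $Z(P)$ acts freely on $\mathrm{Mor}_{\mathcal L}(P,Q)$ by composition (via $\delta_P$), and $\pi$ induces a bijection $\mathrm{Mor}_{\mathcal L}(P,Q)/Z(P)\cong\mathrm{Hom}_{\mathcal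 F}(P,Q)$; (B) $\pi(\delta_{P,Q}(g))=c_g=(x\mapsto gxg^{-1})$ for $g\in T_S(P,Q)$; (C) $f\circ\delta_P(g)=\delta_Q(\pi(f)(g))\circ f$ for $f\in\mathrm{Mor}_{\mathcal L}(P,Q)$ and $g\in P$. Two such systems are isomorphic if there is an isomorphism of categories between them that commutes with the functors $\pi$ and $\delta$. Let $\mathrm{Link}_{\mathcal F}^{\mathcal X}$ be the set of isomorphism classes of $\mathcal X$-linking systems associated to $\mathcal F$. Let $\mathcal O(\mathcal F^c)$ be the category with object set $\mathcal F^c$ and with $\mathrm{Mor}(P,Q)=Q\backslash\mathrm{Hom}_{\mathcal F}(P,Q)$, where $Q$ acts by post-composition with conjugations. Let $\mathcal Z=\mathcal Z_{\mathcal F}^{\mathcal X}\colon\mathcal O(\mathcal F^c)^{\mathrm{op}}\to\mathrm{Ab}$ be the functor with $\mathcal Z(P)=Z(P)$ for $P\in\mathcal X$ and $\mathcal Z(P)=0$ for $P\notin\mathcal X$, which for $P,Q\in\mathcal X$ sends the class of $\varphi\colon P\to Q$ to $\varphi^{-1}\colon Z(Q)\to Z(P)$. Let $\lim^i$ be the $i$-th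 right derived functor of the inverse limit of functors $\mathcal O(\mathcal F^c)^{\mathrm{op}}\to\mathrm{Ab}$. For $i=2,3$ the group $\lim^i\mathcal Z$ is isomorphic to the $i$-th cohomology group of the bar complex $C^n=\prod_{P_0\to\cdots\to P_n}\mathcal Z(P_0)$ with its usual coboundary; fix such isomorphisms (the following holds for every choice of them), and write $[z]\in\lim^i\mathcal Z$ for the class of a cocycle $z$. **(a)** Choose a representative $\sigma(f)\in\mathrm{Hom}_{\mathcal F}(P,Q)$ for each morphism $f\colon P\to Q$ of $\mathcal O(\mathcal F^c)$, and for each pair $P\xrightarrow{f}Q\xrightarrow{g}R$ an element $t(f,g)\in R$ with $\sigma(g)\circ\sigma(f)=c_{t(f,g)}\circ\sigma(gf)$. Let $u\in C^3$ be such that, for each $P\xrightarrow{f}Q\xrightarrow{g}R\xrightarrow{h}T$ with $P\in\mathcal X$, $$\sigma(h)(t(f,g))\cdot t(gf,h)=t(g,h)\cdot t(f,hg)\cdot\sigma(hgf)(u(f,g,h)).$$ Such $\sigma$, $t$, $u$ exist, $u$ is always a cocycle, and its class $o=[u]\in\lim^3\mathcal Z$ does not depend on the choices. The set $\mathrm{Link}_{\mathcal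 F}^{\mathcal X}$ is nonempty if and only if $o=0$. In particular, $\mathrm{Link}_{\mathcal F}^{\mathcal X}\neq\emptyset$ whenever $\lim^3\mathcal Z=0$. **(b)** If $\mathrm{Link}_{\mathcal F}^{\mathcal X}\neq\emptyset$, then the group $\lim^2\mathcal Z$ acts freely and transitively on $\mathrm{Link}_{\mathcal F}^{\mathcal X}$, and hence the two sets have the same cardinality. In this action, for a $2$-cocycle $z$ and linking systems $\mathcal L,\mathcal L'$ (with structural functors $\pi,\delta$ and $\pi',\delta'$), $[z]$ sends the class of $\mathcal L$ to that of $\mathcal L'$ if and only if there are maps $\theta\colon\mathrm{Mor}_{\mathcal L}(P,Q)\to\mathrm{Mor}_{\mathcal L'}(P,Q)$, for $P,Q\in\mathcal X$, with $\pi'(\theta(f))=\pi(f)$, with $\theta(f\circ\delta_P(a))=\theta(f)\circ\delta'_P(a)$ for $a\in P$, and with $$\theta(g\circ f)=\theta(g)\circ\theta(f)\circ\delta'_P(z([\pi(f)],[\pi(g)]))$$ for all $P\xrightarrow{f}Q\xrightarrow{g}R$ in $\mathcal L$. -/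

import Mathlib

open CategoryTheory Opposite

universe u

/-! ### Fusion systems -/

section Transporter

variable {S : Type u} [Group S]

/-- The transporter set `T_S(P, Q)` of all `g : S` with `g P g⁻¹ ≤ Q`. -/
def transporter (P Q : Subgroup S) : Set S :=
  {g | ∀ x ∈ P, g * x * g⁻¹ ∈ Q}

theorem one_mem_transporter (P : Subgroup S) : (1 : S) ∈ transporter P P := by
  intro x hx
  simpa using hx

theorem mul_mem_transporter {P Q R : Subgroup S} {g h : S}
    (hg : g ∈ transporter P Q) (hh : h ∈ transporter Q R) : h * g ∈ transporter P R := by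
  intro x hx
  have := hh _ (hg x hx)
  simpa [mul_assoc] using this

theorem mem_transporter_self {P : Subgroup S} {g : S} (hg : g ∈ P) : g ∈ transporter P P :=
  fun _ hx => P.mul_mem (P.mul_mem hg hx) (P.inv_mem hg)

/-- Left conjugation `c_g : P → Q`, `x ↦ g x g⁻¹`, for `g ∈ T_S(P, Q)`. -/
def conjHom {P Q : Subgroup S} (g : transporter P Q) : P →* Q where
  toFun x := ⟨g.1 * x.1 * g.1⁻¹, g.2 x.1 x.2⟩
  map_one' := by ext; simp
  map_mul' x y := by ext; simp [mul_assoc]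

end Transporter

/-- A fusion system over the group `S`: a category whose objects are the subgroups of `S`, whose
morphisms are injective homomorphisms (with the usual composition), which contains all
homomorphisms induced by conjugation in `S`, and in which each morphism is an isomorphism
of the category followed by an inclusion. -/
structure FusionSystem (S : Type u) [Group S] where
  Hom (P Q : Subgroup S) : Set (P →* Q)
  injective {P Q : Subgroup S} {φ : P →* Q} : φ ∈ Hom P Q → Function.Injective φ
  conj_mem {P Q : Subgroup S} (g : transporter P Q) : conjHom g ∈ Hom P Q
  comp_mem {P Q R : Subgroup S} {φ : P →* Q} {ψ : Q →* R} :
    φ ∈ Hom P Q → ψ ∈ Hom Q R → ψ.comp φ ∈ Hom P R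
  exists_factor {P Q : Subgroup S} {φ : P →* Q} : φ ∈ Hom P Q →
    ∃ (R : Subgroup S) (hR : R ≤ Q) (e : P ≃* R),
      e.toMonoidHom ∈ Hom P R ∧ e.symm.toMonoidHom ∈ Hom R P ∧
        φ = (Subgroup.inclusion hR).comp e.toMonoidHom

namespace FusionSystem

variable {S : Type u} [Group S] (F : FusionSystem S)

theorem id_mem (P : Subgroup S) : MonoidHom.id P ∈ F.Hom P P := by
  have h : conjHom (⟨1, one_mem_transporter P⟩ : transporter P P) = MonoidHom.id P := by
    ext x
    simp [conjHom]
  exact h ▸ F.conj_mem _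

/-- `P` and `Q` are `F`-conjugate: they are isomorphic in the category `F`. -/
def Conj (P Q : Subgroup S) : Prop :=
  ∃ e : P ≃* Q, e.toMonoidHom ∈ F.Hom P Q ∧ e.symm.toMonoidHom ∈ F.Hom Q P

/-- The set `F^c` of `F`-centric subgroups of `S`. -/
def centric : Set (Subgroup S) :=
  {P | ∀ Q, F.Conj P Q → Subgroup.centralizer (Q : Set S) ≤ Q}

/-- `Aut_F(P)`, as a group of automorphisms of `P`. -/
def autGroup (P : Subgroup S) : Subgroup (MulAut P) where
  carrier := {α | MulEquiv.toMonoidHom α ∈ F.Hom P P ∧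
    MulEquiv.toMonoidHom (MulEquiv.symm α) ∈ F.Hom P P}
  one_mem' := ⟨F.id_mem P, F.id_mem P⟩
  mul_mem' := fun ha hb => ⟨F.comp_mem hb.1 ha.1, F.comp_mem ha.2 hb.2⟩
  inv_mem' := fun ha => ⟨ha.2, ha.1⟩

end FusionSystem

/-- `Aut_S(P)`: the automorphisms of `P` induced by conjugation by elements of `N_S(P)`. -/
def autS {S : Type u} [Group S] (P : Subgroup S) : Subgroup (MulAut P) :=
  P.normalizerMonoidHom.range

/-- For an isomorphism `φ : Q → P`, the subgroup
`N_φ = {g ∈ N_S(Q) | φ c_g φ⁻¹ ∈ Aut_S(P)}` of `S`. -/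
def extensionDomain {S : Type u} [Group S] {Q P : Subgroup S} (φ : Q ≃* P) : Subgroup S :=
  ((autS P).comap
    ((MulAut.congr φ).toMonoidHom.comp Q.normalizerMonoidHom)).map
      (Subgroup.normalizer (Q : Set S)).subtype

namespace FusionSystem

variable {S : Type u} [Group S] (F : FusionSystem S)

/-- `P` is fully automized: `Aut_S(P)` is a Sylow `p`-subgroup of `Aut_F(P)`. -/
def FullyAutomized (p : ℕ) (P : Subgroup S) : Prop :=
  ∃ A : Sylow p (F.autGroup P), (A : Subgroup (F.autGroup P)) = (autS P).subgroupOf (F.autGroup P)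

/-- `P` is receptive: each isomorphism `φ ∈ Iso_F(Q, P)` extends to a morphism `N_φ → S` in `F`. -/
def Receptive (P : Subgroup S) : Prop :=
  ∀ (Q : Subgroup S) (φ : Q ≃* P), φ.toMonoidHom ∈ F.Hom Q P → φ.symm.toMonoidHom ∈ F.Hom P Q →
    ∃ ψ ∈ F.Hom (extensionDomain φ) ⊤,
      ∀ (x : S) (hx : x ∈ Q) (hx' : x ∈ extensionDomain φ),
        (ψ ⟨x, hx'⟩ : S) = (φ ⟨x, hx⟩ : S)

/-- `F` is saturated: each subgroup of `S` is `F`-conjugate to one which is fully automized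
and receptive. -/
def IsSaturated (p : ℕ) : Prop :=
  ∀ P : Subgroup S, ∃ Q : Subgroup S, F.Conj P Q ∧ F.FullyAutomized p Q ∧ F.Receptive Q

/-- `X` is a family of `F`-centric subgroups closed under `F`-conjugacy and overgroups. -/
structure IsClosedFamily (X : Set (Subgroup S)) : Prop where
  centric : X ⊆ F.centric
  conj_mem : ∀ P ∈ X, ∀ Q, F.Conj P Q → Q ∈ X
  overgroup_mem : ∀ P ∈ X, ∀ Q, P ≤ Q → Q ∈ X

/-- Identity morphisms of the category `F`. -/
def homId (P : Subgroup S) : F.Hom P P := ⟨MonoidHom.id P, F.id_mem P⟩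

/-- `φ.homComp ψ` is `φ` followed by `ψ`, in the category `F`. -/
def homComp {P Q R : Subgroup S} (φ : F.Hom P Q) (ψ : F.Hom Q R) : F.Hom P R :=
  ⟨ψ.1.comp φ.1, F.comp_mem φ.2 ψ.2⟩

/-- The morphism `c_g` of `F`, for `g ∈ T_S(P, Q)`. -/
def homConj {P Q : Subgroup S} (g : transporter P Q) : F.Hom P Q := ⟨conjHom g, F.conj_mem g⟩

/-! ### Linking systems -/

/-- An `X`-linking system associated to `F`: a category with object set `X`, with functors
`π` to `F^X` and `δ` from the transporter category `T^X(S)`, both the identity on objects.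
Here `comp f f'` is `f` followed by `f'`. -/
structure LinkingSystem (X : Set (Subgroup S)) where
  /-- the category -/
  Mor : X → X → Type u
  id (P : X) : Mor P P
  comp {P Q R : X} : Mor P Q → Mor Q R → Mor P R
  id_comp {P Q : X} (f : Mor P Q) : comp (id P) f = f
  comp_id {P Q : X} (f : Mor P Q) : comp f (id Q) = f
  assoc {P Q R T : X} (f : Mor P Q) (g : Mor Q R) (h : Mor R T) :
    comp (comp f g) h = comp f (comp g h)
  /-- the functor `π` -/
  π {P Q : X} : Mor P Q → F.Hom P.1 Q.1
  π_id (P : X) : π (id P) = F.homId P.1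
  π_comp {P Q R : X} (f : Mor P Q) (g : Mor Q R) : π (comp f g) = F.homComp (π f) (π g)
  /-- the functor `δ` -/
  δ {P Q : X} : transporter P.1 Q.1 → Mor P Q
  δ_one (P : X) : δ ⟨1, one_mem_transporter P.1⟩ = id P
  δ_mul {P Q R : X} (g : transporter P.1 Q.1) (h : transporter Q.1 R.1) :
    δ ⟨h.1 * g.1, mul_mem_transporter g.2 h.2⟩ = comp (δ g) (δ h)
  /-- (A): `π` is surjective on morphisms -/
  π_surjective {P Q : X} : Function.Surjective (π : Mor P Q → F.Hom P.1 Q.1)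
  /-- (A): `Z(P)` acts freely on `Mor P Q` -/
  free {P Q : X} (f : Mor P Q) (z : P.1) (hz : z ∈ Subgroup.center P.1) :
    comp (δ ⟨z.1, mem_transporter_self z.2⟩) f = f → z = 1
  /-- (A): `π` induces a bijection from `Mor P Q / Z(P)` to `Hom_F(P, Q)` -/
  π_eq_iff {P Q : X} (f f' : Mor P Q) :
    π f = π f' ↔ ∃ z : P.1, z ∈ Subgroup.center P.1 ∧
      f' = comp (δ ⟨z.1, mem_transporter_self z.2⟩) f
  /-- (B) -/
  π_δ {P Q : X} (g : transporter P.1 Q.1) : π (δ g) = F.homConj g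
  /-- (C) -/
  δ_comp {P Q : X} (f : Mor P Q) (g : P.1) :
    comp (δ ⟨g.1, mem_transporter_self g.2⟩) f =
      comp f (δ ⟨((π f).1 g).1, mem_transporter_self ((π f).1 g).2⟩)

namespace LinkingSystem

variable {F} {X : Set (Subgroup S)}

/-- The automorphism `δ_P(g)` of `P`, for `g ∈ P`. -/
def δSelf (L : F.LinkingSystem X) (P : X) (g : P.1) : L.Mor P P :=
  L.δ ⟨g.1, mem_transporter_self g.2⟩

/-- Isomorphism of linking systems: an isomorphism of categories that commutes with the structural
functors `π` and `δ` (hence is the identity on objects). -/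
def Iso (L L' : F.LinkingSystem X) : Prop :=
  ∃ Ψ : ∀ P Q : X, L.Mor P Q ≃ L'.Mor P Q,
    (∀ P, Ψ P P (L.id P) = L'.id P) ∧
    (∀ (P Q R : X) (f : L.Mor P Q) (g : L.Mor Q R),
      Ψ P R (L.comp f g) = L'.comp (Ψ P Q f) (Ψ Q R g)) ∧
    (∀ (P Q : X) (f : L.Mor P Q), L'.π (Ψ P Q f) = L.π f) ∧
    (∀ (P Q : X) (g : transporter P.1 Q.1), Ψ P Q (L.δ g) = L'.δ g)

variable (F X) in
/-- The setoid on linking systems given by isomorphism. -/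
def isoSetoid : Setoid (F.LinkingSystem X) where
  r := Iso
  iseqv :=
    { refl := fun L => ⟨fun _ _ => Equiv.refl _, by simp, by simp, by simp, by simp⟩
      symm := by
        rintro L L' ⟨Ψ, h1, h2, h3, h4⟩
        refine ⟨fun P Q => (Ψ P Q).symm, ?_, ?_, ?_, ?_⟩
        · intro P
          rw [Equiv.symm_apply_eq, h1]
        · intro P Q R f g
          rw [Equiv.symm_apply_eq, h2]
          simp
        · intro P Q f
          rw [← h3]
          simp
        · intro P Q g
          rw [Equiv.symm_apply_eq, h4]
      trans := by
        rintro L L' L'' ⟨Ψ, h1, h2, h3, h4⟩ ⟨Ψ', h1', h2', h3', h4'⟩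
        refine ⟨fun P Q => (Ψ P Q).trans (Ψ' P Q), ?_, ?_, ?_, ?_⟩
        · intro P
          simp [h1, h1']
        · intro P Q R f g
          simp [h2, h2']
        · intro P Q f
          simp [h3, h3']
        · intro P Q g
          simp [h4, h4'] }

end LinkingSystem

/-- The set of isomorphism classes of `X`-linking systems associated to `F`. -/
def LinkingClasses (X : Set (Subgroup S)) : Type (u + 1) :=
  Quotient (LinkingSystem.isoSetoid F X)

/-- The isomorphism class of a linking system. -/
def LinkingSystem.toClass {F : FusionSystem S} {X : Set (Subgroup S)} (L : F.LinkingSystem X) :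
    F.LinkingClasses X :=
  Quotient.mk (LinkingSystem.isoSetoid F X) L

/-! ### The orbit category -/

/-- `Q` acts on `Hom_F(P, Q)` by post-composition with inner automorphisms. -/
def orbitSetoid (P Q : Subgroup S) : Setoid (F.Hom P Q) where
  r φ ψ := ∃ q : Q, ∀ x, ψ.1 x = q * φ.1 x * q⁻¹
  iseqv :=
    { refl := fun φ => ⟨1, by simp⟩
      symm := by
        rintro φ ψ ⟨q, hq⟩
        exact ⟨q⁻¹, fun x => by rw [hq]; group⟩
      trans := by
        rintro φ ψ χ ⟨q, hq⟩ ⟨r, hr⟩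
        exact ⟨r * q, fun x => by rw [hr, hq]; group⟩ }

/-- Objects of the full subcategory, with object set `Y`, of the orbit category of `F`. -/
structure OrbitCategory {S : Type u} [Group S] (F : FusionSystem S) (Y : Set (Subgroup S)) :
    Type u where
  obj : Subgroup S
  mem : obj ∈ Y

/-- Morphisms from `P` to `Q` in the orbit category: the set `Q \ Hom_F(P, Q)`. -/
instance {Y : Set (Subgroup S)} : Category.{u} (F.OrbitCategory Y) where
  Hom P Q := Quotient (F.orbitSetoid P.obj Q.obj)
  id P := Quotient.mk _ (F.homId P.obj)
  comp {P Q R} f g := Quotient.map₂ (sa := F.orbitSetoid P.obj Q.obj)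
    (sb := F.orbitSetoid Q.obj R.obj) (sc := F.orbitSetoid P.obj R.obj)
    (fun φ ψ => F.homComp φ ψ) (by
      rintro φ φ' ⟨q, hq⟩ ψ ψ' ⟨r, hr⟩
      refine ⟨r * ψ.1 q, fun x => ?_⟩
      simp only [homComp, MonoidHom.comp_apply, hq, hr, map_mul, map_inv]
      group) f g
  id_comp f := by
    induction f using Quotient.inductionOn
    rfl
  comp_id f := by
    induction f using Quotient.inductionOn
    rfl
  assoc f g h := by
    induction f using Quotient.inductionOn
    induction g using Quotient.inductionOn
    induction h using Quotient.inductionOn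
    rfl

/-- The class in the orbit category of a morphism of `F`. -/
def orbitClass {Y : Set (Subgroup S)} {P Q : F.OrbitCategory Y} (φ : F.Hom P.obj Q.obj) : P ⟶ Q :=
  Quotient.mk (F.orbitSetoid P.obj Q.obj) φ

/-! ### The functor `Z_F^X` -/

/-- The group `Z(P)` if `P ∈ X`, and the trivial group otherwise. -/
def centerOn (X : Set (Subgroup S)) (P : Subgroup S) : Subgroup P where
  carrier := {z | z ∈ Subgroup.center P ∧ (P ∉ X → z = 1)}
  one_mem' := ⟨Subgroup.one_mem _, fun _ => rfl⟩
  mul_mem' := fun ha hb => ⟨Subgroup.mul_mem _ ha.1 hb.1, fun h => by simp [ha.2 h, hb.2 h]⟩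
  inv_mem' := fun ha => ⟨Subgroup.inv_mem _ ha.1, fun h => by simp [ha.2 h]⟩

instance (X : Set (Subgroup S)) (P : Subgroup S) : CommGroup (centerOn X P) where
  mul_comm a b := Subtype.ext (Subgroup.mem_center_iff.mp b.2.1 a.1)

variable {F} {X : Set (Subgroup S)}

theorem centerOn_ext {P : Subgroup S} {w w' : centerOn X P} (h : P ∈ X → w.1 = w'.1) : w = w' := by
  by_cases hP : P ∈ X
  · exact Subtype.ext (h hP)
  · exact Subtype.ext ((w.2.2 hP).trans (w'.2.2 hP).symm)

/-- The preimage under a morphism `φ : P → Q` in `F` of a central element of `Q`. -/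
theorem exists_centerOn_map (hX : F.IsClosedFamily X) {P Q : F.OrbitCategory F.centric}
    (f : P ⟶ Q) (z : centerOn X Q.obj) :
    ∃ w : centerOn X P.obj, P.obj ∈ X →
      ∀ φ : F.Hom P.obj Q.obj, F.orbitClass φ = f → φ.1 w.1 = z.1 := by
  induction f using Quotient.inductionOn with
  | h φ =>
  by_cases hP : P.obj ∈ X
  swap
  · exact ⟨1, fun h => absurd h hP⟩
  obtain ⟨R, hR, e, he, he', hφ⟩ := F.exists_factor φ.2
  have hc := hX.centric hP R ⟨e, he, he'⟩
  have hz : (z.1.1 : S) ∈ R := by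
    apply hc
    rw [Subgroup.mem_centralizer_iff]
    intro x hx
    exact congrArg Subtype.val (Subgroup.mem_center_iff.mp z.2.1 ⟨x, hR hx⟩)
  have hw : φ.1 (e.symm ⟨z.1.1, hz⟩) = z.1 := by
    rw [hφ]
    ext
    simp
  refine ⟨⟨e.symm ⟨z.1.1, hz⟩, ?_, fun h => absurd hP h⟩, fun _ ψ hψ => ?_⟩
  · rw [Subgroup.mem_center_iff]
    intro x
    apply F.injective φ.2
    rw [map_mul, map_mul, hw]
    exact Subgroup.mem_center_iff.mp z.2.1 _
  · obtain ⟨q, hq⟩ := Quotient.exact hψ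
    have h1 := hw.symm.trans (hq (e.symm ⟨z.1.1, hz⟩))
    have h2 : ψ.1 (e.symm ⟨z.1.1, hz⟩) = q⁻¹ * (z.1 * q) := by
      refine Eq.trans ?_ (congrArg (fun y => q⁻¹ * (y * q)) h1).symm
      group
    refine h2.trans ?_
    rw [← Subgroup.mem_center_iff.mp z.2.1 q]
    group

/-- The homomorphism `φ⁻¹ : Z(Q) → Z(P)` induced by the class of `φ` (trivial if `P ∉ X`). -/
noncomputable def centerOnMap (hX : F.IsClosedFamily X) {P Q : F.OrbitCategory F.centric}
    (f : P ⟶ Q) (z : centerOn X Q.obj) : centerOn X P.obj :=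
  (exists_centerOn_map hX f z).choose

theorem centerOnMap_spec (hX : F.IsClosedFamily X) {P Q : F.OrbitCategory F.centric}
    (φ : F.Hom P.obj Q.obj) (z : centerOn X Q.obj) (hP : P.obj ∈ X) :
    φ.1 (centerOnMap hX (F.orbitClass φ : P ⟶ Q) z).1 = z.1 :=
  (exists_centerOn_map hX (F.orbitClass φ : P ⟶ Q) z).choose_spec hP φ rfl

theorem centerOnMap_eq (hX : F.IsClosedFamily X) {P Q : F.OrbitCategory F.centric}
    (φ : F.Hom P.obj Q.obj) (z : centerOn X Q.obj) (w : centerOn X P.obj)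
    (h : P.obj ∈ X → φ.1 w.1 = z.1) : centerOnMap hX (F.orbitClass φ : P ⟶ Q) z = w :=
  centerOn_ext fun hP => F.injective φ.2 ((centerOnMap_spec hX φ z hP).trans (h hP).symm)

theorem mem_of_hom (hX : F.IsClosedFamily X) {P Q : Subgroup S} (φ : F.Hom P Q) (hP : P ∈ X) :
    Q ∈ X := by
  obtain ⟨R, hR, e, he, he', -⟩ := F.exists_factor φ.2
  exact hX.overgroup_mem R (hX.conj_mem P hP R ⟨e, he, he'⟩) Q hR

theorem centerOnMap_mul (hX : F.IsClosedFamily X) {P Q : F.OrbitCategory F.centric}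
    (f : P ⟶ Q) (a b : centerOn X Q.obj) :
    centerOnMap hX f (a * b) = centerOnMap hX f a * centerOnMap hX f b := by
  obtain ⟨φ, rfl⟩ := Quotient.exists_rep f
  refine centerOnMap_eq hX φ _ _ fun hP => ?_
  have ha := centerOnMap_spec hX φ a hP
  have hb := centerOnMap_spec hX φ b hP
  exact (map_mul φ.1 _ _).trans (congrArg₂ (· * ·) ha hb)

theorem centerOnMap_id (hX : F.IsClosedFamily X) (P : F.OrbitCategory F.centric)
    (a : centerOn X P.obj) : centerOnMap hX (𝟙 P) a = a :=
  centerOnMap_eq hX (F.homId P.obj) _ _ fun _ => rfl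

theorem centerOnMap_comp (hX : F.IsClosedFamily X) {P Q R : F.OrbitCategory F.centric}
    (f : P ⟶ Q) (g : Q ⟶ R) (a : centerOn X R.obj) :
    centerOnMap hX (f ≫ g) a = centerOnMap hX f (centerOnMap hX g a) := by
  obtain ⟨φ, rfl⟩ := Quotient.exists_rep f
  obtain ⟨ψ, rfl⟩ := Quotient.exists_rep g
  refine centerOnMap_eq hX (F.homComp φ ψ) _ _ fun hP => ?_
  have h1 := centerOnMap_spec hX φ (centerOnMap hX (F.orbitClass ψ : Q ⟶ R) a) hP
  have h2 := centerOnMap_spec hX ψ a (mem_of_hom hX φ hP)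
  exact (congrArg ψ.1 h1).trans h2

/-- The functor `Z_F^X : O(F^c)ᵒᵖ → Ab`, which sends `P` to `Z(P)` if `P ∈ X` and to `0` if
`P ∉ X`, and sends the class of `φ : P → Q` to `φ⁻¹ : Z(Q) → Z(P)` for `P, Q ∈ X`. -/
noncomputable def centerFunctor (hX : F.IsClosedFamily X) :
    (F.OrbitCategory F.centric)ᵒᵖ ⥤ AddCommGrpCat.{u} where
  obj P := AddCommGrpCat.of (Additive (centerOn X P.unop.obj))
  map f := AddCommGrpCat.ofHom (MonoidHom.toAdditive
    (MonoidHom.mk' (centerOnMap hX f.unop) (centerOnMap_mul hX f.unop)))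
  map_id P := AddCommGrpCat.hom_ext (AddMonoidHom.ext fun z =>
    congrArg Additive.ofMul (centerOnMap_id hX P.unop (Additive.toMul z)))
  map_comp g f := AddCommGrpCat.hom_ext (AddMonoidHom.ext fun z =>
    congrArg Additive.ofMul (centerOnMap_comp hX f.unop g.unop (Additive.toMul z)))

/-- The element of `P` underlying an element of `Z_F^X(P)`. -/
def centerVal {hX : F.IsClosedFamily X} {P : F.OrbitCategory F.centric}
    (z : (centerFunctor hX).obj (op P)) : P.obj :=
  ((Additive.toMul (α := centerOn X P.obj) z : centerOn X P.obj) : P.obj)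

end FusionSystem

/-! ### Higher limits -/

namespace HigherLimits

section Derived

variable (C : Type u) [SmallCategory C]

instance isGrothendieckAbelian_presheaf :
    IsGrothendieckAbelian.{u} (Cᵒᵖ ⥤ AddCommGrpCat.{u}) :=
  IsGrothendieckAbelian.of_equivalence (sheafBotEquivalence AddCommGrpCat.{u})

instance lim_additive :
    (Limits.lim : (Cᵒᵖ ⥤ AddCommGrpCat.{u}) ⥤ AddCommGrpCat.{u}).Additive :=
  Functor.additive_of_preserves_binary_products _

variable {C}

/-- `lim^n(G)`: the `n`-th right derived functor of the inverse limit, for contravariant functors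
on `C`. -/
noncomputable def higherLim (n : ℕ) (G : Cᵒᵖ ⥤ AddCommGrpCat.{u}) : AddCommGrpCat.{u} :=
  ((Limits.lim : (Cᵒᵖ ⥤ AddCommGrpCat.{u}) ⥤ AddCommGrpCat.{u}).rightDerived n).obj G

end Derived

section Bar

variable {C : Type u} [SmallCategory C] (G : Cᵒᵖ ⥤ AddCommGrpCat.{u})

/-- `1`-cochains: functions sending `P ⟶ Q` to an element of `G(P)`. -/
abbrev Cochain₁ : Type u := ∀ P Q : C, (P ⟶ Q) → G.obj (op P)

/-- `2`-cochains: functions sending `P ⟶ Q ⟶ R` to an element of `G(P)`. -/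
abbrev Cochain₂ : Type u := ∀ P Q R : C, (P ⟶ Q) → (Q ⟶ R) → G.obj (op P)

/-- `3`-cochains. -/
abbrev Cochain₃ : Type u :=
  ∀ P Q R T : C, (P ⟶ Q) → (Q ⟶ R) → (R ⟶ T) → G.obj (op P)

/-- `4`-cochains. -/
abbrev Cochain₄ : Type u :=
  ∀ P Q R T U : C, (P ⟶ Q) → (Q ⟶ R) → (R ⟶ T) → (T ⟶ U) → G.obj (op P)

/-- The coboundary from `1`-cochains to `2`-cochains. -/
def d₁ : Cochain₁ G →+ Cochain₂ G where
  toFun c P Q R f g := G.map f.op (c Q R g) - c P R (f ≫ g) + c P Q f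
  map_zero' := by
    funext P Q R f g
    simp
  map_add' c c' := by
    funext P Q R f g
    simp only [Pi.add_apply, map_add]
    abel

/-- The coboundary from `2`-cochains to `3`-cochains. -/
def d₂ : Cochain₂ G →+ Cochain₃ G where
  toFun c P Q R T f g h :=
    G.map f.op (c Q R T g h) - c P R T (f ≫ g) h + c P Q T f (g ≫ h) - c P Q R f g
  map_zero' := by
    funext P Q R T f g h
    simp
  map_add' c c' := by
    funext P Q R T f g h
    simp only [Pi.add_apply, map_add]
    abel

/-- The coboundary from `3`-cochains to `4`-cochains. -/
def d₃ : Cochain₃ G →+ Cochain₄ G where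
  toFun c P Q R T U f g h k :=
    G.map f.op (c Q R T U g h k) - c P R T U (f ≫ g) h k + c P Q T U f (g ≫ h) k
      - c P Q R U f g (h ≫ k) + c P Q R T f g h
  map_zero' := by
    funext P Q R T U f g h k
    simp
  map_add' c c' := by
    funext P Q R T U f g h k
    simp only [Pi.add_apply, map_add]
    abel

/-- The group of `2`-cocycles. -/
abbrev Cocycle₂ : AddSubgroup (Cochain₂ G) := (d₂ G).ker

/-- The group of `3`-cocycles. -/
abbrev Cocycle₃ : AddSubgroup (Cochain₃ G) := (d₃ G).ker

/-- The second cohomology group of the bar complex of `G`: cocycles modulo coboundaries. -/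
abbrev BarH₂ : Type u := Cocycle₂ G ⧸ (d₁ G).range.addSubgroupOf (Cocycle₂ G)

/-- The third cohomology group of the bar complex of `G`: cocycles modulo coboundaries. -/
abbrev BarH₃ : Type u := Cocycle₃ G ⧸ (d₂ G).range.addSubgroupOf (Cocycle₃ G)

variable {G}

/-- The class of a `2`-cocycle. -/
def class₂ (z : Cocycle₂ G) : BarH₂ G := QuotientAddGroup.mk z

/-- The class of a `3`-cocycle. -/
def class₃ (z : Cocycle₃ G) : BarH₃ G := QuotientAddGroup.mk z

end Bar

end HigherLimits

/-! ### The obstruction cocycle and the twisting of linking systems -/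

namespace FusionSystem

open HigherLimits

variable {S : Type u} [Group S] {F : FusionSystem S} {X : Set (Subgroup S)}

/-- `u` is an obstruction cochain for the existence of an `X`-linking system. There are
* a choice `σ(f)`, for each morphism `f` of `O(F^c)`, of a morphism of `F` in the class `f`, and
* elements `t(f, g) ∈ R`, for each `P --f--> Q --g--> R` in `O(F^c)`, such that
  `σ(g) ∘ σ(f) = c_{t(f, g)} ∘ σ(g ∘ f)`,

and `u` measures the failure of associativity of the multiplication on the sets
`Q × Mor_{O(F^c)}(P, Q)` defined by these choices: if `P --f--> Q --g--> R --h--> T` with `P ∈ X`,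
then `u(f, g, h) ∈ Z(P)` is the element for which
`σ(h)(t(f, g)) t(g ∘ f, h) = t(g, h) t(f, h ∘ g) σ(h ∘ g ∘ f)(u(f, g, h))`.
(For `P ∉ X`, `u(f, g, h)` lies in the zero group `Z_F^X(P)`.) -/
def IsObstructionCochain (hX : F.IsClosedFamily X) (u : Cochain₃ (centerFunctor hX)) : Prop :=
  ∃ (σ : ∀ P Q : F.OrbitCategory F.centric, (P ⟶ Q) → F.Hom P.obj Q.obj)
    (t : ∀ P Q R : F.OrbitCategory F.centric, (P ⟶ Q) → (Q ⟶ R) → R.obj),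
    (∀ P Q f, F.orbitClass (σ P Q f) = f) ∧
    (∀ P Q R f g (x : P.obj),
      (σ Q R g).1 ((σ P Q f).1 x) =
        t P Q R f g * (σ P R (f ≫ g)).1 x * (t P Q R f g)⁻¹) ∧
    (∀ P Q R T f g h, P.obj ∈ X →
      (σ R T h).1 (t P Q R f g) * t P R T (f ≫ g) h =
        t Q R T g h * t P Q T f (g ≫ h) *
          (σ P T (f ≫ g ≫ h)).1 (centerVal (u P Q R T f g h)))

/-- The object of `O(F^c)` given by a member of `X`. -/
def IsClosedFamily.toOrbit (hX : F.IsClosedFamily X) (P : X) : F.OrbitCategory F.centric :=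
  ⟨P.1, hX.centric P.2⟩

/-- The class in `O(F^c)` of (the image under `π` of) a morphism of a linking system. -/
def LinkingSystem.orbitMor (L : F.LinkingSystem X) (hX : F.IsClosedFamily X) {P Q : X}
    (f : L.Mor P Q) : hX.toOrbit P ⟶ hX.toOrbit Q :=
  F.orbitClass (P := hX.toOrbit P) (Q := hX.toOrbit Q) (L.π f)

/-- `L'` is a twist of the linking system `L` by the `2`-cochain `z`: up to maps `θ` between the
morphism sets, which commute with `π` and with the action of `P` on the morphisms out of `P`, the
composition in `L` is the composition in `L'` multiplied by `z`, that is
`θ(g ∘ f) = θ(g) ∘ θ(f) ∘ δ'_P(z([f], [g]))` for `P --f--> Q --g--> R` in `L`. -/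
def IsTwist (hX : F.IsClosedFamily X) (z : Cochain₂ (centerFunctor hX))
    (L L' : F.LinkingSystem X) : Prop :=
  ∃ θ : ∀ P Q : X, L.Mor P Q → L'.Mor P Q,
    (∀ (P Q : X) (f : L.Mor P Q), L'.π (θ P Q f) = L.π f) ∧
    (∀ (P Q : X) (a : P.1) (f : L.Mor P Q),
      θ P Q (L.comp (L.δSelf P a) f) = L'.comp (L'.δSelf P a) (θ P Q f)) ∧
    (∀ (P Q R : X) (f : L.Mor P Q) (g : L.Mor Q R),
      θ P R (L.comp f g) =
        L'.comp (L'.δSelf P (centerVal (z (hX.toOrbit P) (hX.toOrbit Q) (hX.toOrbit R)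
          (L.orbitMor hX f) (L.orbitMor hX g)))) (L'.comp (θ P Q f) (θ Q R g)))

end FusionSystem

open FusionSystem HigherLimits

/-! A linking system is a kind of extension of the orbit category by the groups in `X`. Because the
members of `X` are centric, `Q` acts freely on `Mor_L(P, Q)` by post-composition, and its orbits are
the morphisms `P → Q` of `O(F^c)` (`comp_δSelf_injective`, `exists_comp_δSelf`). Choosing a lift of
each orbit morphism turns `Mor_L(P, Q)` into `Q × Mor_O(P, Q)`, with `(q, f)` lying over `c_q ∘
σ(f)` and composition governed by the elements `t(f, g)`.

(a) For arbitrary `σ` and `t` this product is associative up to elements `u(f, g, h)` of `Z(P)`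
(`IsLift.exists_isDefect`). A pentagon-type computation shows that `u` is a cocycle (`cocycle_aux`).
A change of `σ` can be compensated in `t` without changing `u` (`IsLift.change`), and a change of
`t` by a 2-cochain alters `u` by its coboundary (`IsDefect.sub_d₂`). So the class of `u` vanishes
exactly when some choice is strictly associative. Such a choice yields a linking system
(`AssocLift.toPreLinkingSystem`), apart from the values of `δ` outside the groups `P` themselves;
these are recovered by choosing inclusions `P → S` and cancelling them
(`exists_transporter_extension`). Conversely, lifts chosen inside a linking system have `u = 0`.

(b) Matching the orbits of two linking systems equivariantly gives maps `θ` which preserve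
composition up to a 2-cochain in the centers (`exists_isTwist`). Associativity makes it a cocycle,
and it is unique modulo coboundaries (`IsTwist.exists_d₁_eq`). Every cocycle occurs, by altering the
composition (`exists_isTwist_left`), and a twist by zero can be corrected to an isomorphism that
respects `δ` (`IsTwist.iso`).

The identification with derived limits is dimension shifting. An injective functor is a retract of a
coinduced one, whose bar complex is contractible in positive degrees. Hence the connecting maps
along an injective resolution are isomorphisms, down to degree one, where the bar cohomology of a
cosyzygy is compared with the homology of the limits (`higherLim_equiv_barH₁`). -/

/-! ### Isomorphisms of subquotients -/

section Subquotient

/-- An additive relation between `M` and `N` which is total in both directions and matches the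
subgroup `M₀` with `N₀` induces an isomorphism `M ⧸ M₀ ≃+ N ⧸ N₀`. -/
theorem QuotientAddGroup.nonempty_equiv_of_relation {M N : Type*} [AddCommGroup M] [AddCommGroup N]
    (M₀ : AddSubgroup M) (N₀ : AddSubgroup N) (R : AddSubgroup (M × N))
    (hM : ∀ m, ∃ n, (m, n) ∈ R) (hN : ∀ n, ∃ m, (m, n) ∈ R)
    (h : ∀ m n, (m, n) ∈ R → (m ∈ M₀ ↔ n ∈ N₀)) :
    Nonempty (M ⧸ M₀ ≃+ N ⧸ N₀) := by
  -- Both projections of `R` to the quotients are surjective, and `h` says that they have the same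
  -- kernel, so both quotients are `R` modulo that kernel.
  let a : R →+ M ⧸ M₀ := (QuotientAddGroup.mk' M₀).comp ((AddMonoidHom.fst M N).comp R.subtype)
  let b : R →+ N ⧸ N₀ := (QuotientAddGroup.mk' N₀).comp ((AddMonoidHom.snd M N).comp R.subtype)
  have ha : Function.Surjective a := by
    intro q
    obtain ⟨m, rfl⟩ := QuotientAddGroup.mk_surjective q
    obtain ⟨n, hn⟩ := hM m
    exact ⟨⟨(m, n), hn⟩, rfl⟩
  have hb : Function.Surjective b := by
    intro q
    obtain ⟨n, rfl⟩ := QuotientAddGroup.mk_surjective q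
    obtain ⟨m, hm⟩ := hN n
    exact ⟨⟨(m, n), hm⟩, rfl⟩
  have hab : a.ker = b.ker := by
    ext ⟨⟨m, n⟩, hr⟩
    simp only [AddMonoidHom.mem_ker]
    exact (QuotientAddGroup.eq_zero_iff m).trans
      ((h m n hr).trans (QuotientAddGroup.eq_zero_iff n).symm)
  exact ⟨(QuotientAddGroup.quotientKerEquivOfSurjective a ha).symm.trans
    ((QuotientAddGroup.quotientAddEquivOfEq hab).trans
      (QuotientAddGroup.quotientKerEquivOfSurjective b hb))⟩

/-- The connecting isomorphism of a short exact sequence of complexes `A → B → D`, if the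
complex `B` is exact in two consecutive degrees. -/
theorem nonempty_connecting_equiv {A₁ A₂ A₃ B₀ B₁ B₂ B₃ D₀ D₁ D₂ : Type*}
    [AddCommGroup A₁] [AddCommGroup A₂] [AddCommGroup A₃]
    [AddCommGroup B₀] [AddCommGroup B₁] [AddCommGroup B₂] [AddCommGroup B₃]
    [AddCommGroup D₀] [AddCommGroup D₁] [AddCommGroup D₂]
    (a₁ : A₁ →+ A₂) (a₂ : A₂ →+ A₃) (b₀ : B₀ →+ B₁) (b₁ : B₁ →+ B₂) (b₂ : B₂ →+ B₃)
    (c₀ : D₀ →+ D₁) (c₁ : D₁ →+ D₂)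
    (i₁ : A₁ →+ B₁) (i₂ : A₂ →+ B₂) (i₃ : A₃ →+ B₃)
    (p₀ : B₀ →+ D₀) (p₁ : B₁ →+ D₁) (p₂ : B₂ →+ D₂)
    (hi₁ : ∀ x, i₂ (a₁ x) = b₁ (i₁ x)) (hi₂ : ∀ x, i₃ (a₂ x) = b₂ (i₂ x))
    (hp₀ : ∀ x, p₁ (b₀ x) = c₀ (p₀ x)) (hp₁ : ∀ x, p₂ (b₁ x) = c₁ (p₁ x))
    (inj₂ : Function.Injective i₂) (inj₃ : Function.Injective i₃)
    (sur₀ : Function.Surjective p₀) (sur₁ : Function.Surjective p₁)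
    (ex₁ : ∀ x, p₁ x = 0 ↔ ∃ y, i₁ y = x) (ex₂ : ∀ x, p₂ x = 0 ↔ ∃ y, i₂ y = x)
    (hb₁ : ∀ x, b₁ x = 0 ↔ ∃ y, b₀ y = x) (hb₂ : ∀ x, b₂ x = 0 ↔ ∃ y, b₁ y = x) :
    Nonempty (c₁.ker ⧸ c₀.range.addSubgroupOf c₁.ker ≃+
      a₂.ker ⧸ a₁.range.addSubgroupOf a₂.ker) := by
  -- The zig-zag relation of the snake lemma: `m` and `n` are related if some `b` lifts `m` and has
  -- boundary `n`. Writing it as the image of a kernel makes it a subgroup for free.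
  let f : c₁.ker × a₂.ker × B₁ →+ D₁ × B₂ :=
    { toFun := fun x => (p₁ x.2.2 - x.1.1, b₁ x.2.2 - i₂ x.2.1.1)
      map_zero' := by simp
      map_add' := by
        intro x y
        ext <;> simp <;> abel }
  let g : c₁.ker × a₂.ker × B₁ →+ c₁.ker × a₂.ker :=
    { toFun := fun x => (x.1, x.2.1)
      map_zero' := rfl
      map_add' := fun _ _ => rfl }
  have key : ∀ m n, (m, n) ∈ f.ker.map g ↔ ∃ b, p₁ b = m.1 ∧ b₁ b = i₂ n.1 := by
    intro m n
    constructor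
    · rintro ⟨⟨m', n', b⟩, h, h'⟩
      obtain ⟨rfl, rfl⟩ := Prod.ext_iff.mp h'
      have h := Prod.ext_iff.mp h
      exact ⟨b, sub_eq_zero.mp h.1, sub_eq_zero.mp h.2⟩
    · rintro ⟨b, h1, h2⟩
      exact ⟨(m, n, b), Prod.ext (sub_eq_zero.mpr h1) (sub_eq_zero.mpr h2), rfl⟩
  apply QuotientAddGroup.nonempty_equiv_of_relation _ _ (f.ker.map g)
  · rintro ⟨m, hm⟩
    obtain ⟨b, rfl⟩ := sur₁ m
    obtain ⟨a, ha⟩ := (ex₂ (b₁ b)).mp ((hp₁ b).trans hm)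
    refine ⟨⟨a, inj₃ ?_⟩, (key _ _).mpr ⟨b, rfl, ha.symm⟩⟩
    rw [hi₂, ha, map_zero]
    exact (hb₂ _).mpr ⟨b, rfl⟩
  · rintro ⟨n, hn⟩
    obtain ⟨b, hb⟩ := (hb₂ (i₂ n)).mp (by rw [← hi₂, show a₂ n = 0 from hn, map_zero])
    refine ⟨⟨p₁ b, ?_⟩, (key _ _).mpr ⟨b, rfl, hb⟩⟩
    rw [AddMonoidHom.mem_ker, ← hp₁, hb]
    exact (ex₂ _).mpr ⟨n, rfl⟩
  · rintro ⟨m, hm⟩ ⟨n, hn⟩ h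
    obtain ⟨b, h1, h2⟩ := (key _ _).mp h
    simp only [AddSubgroup.mem_addSubgroupOf, AddMonoidHom.mem_range]
    simp only at h1 h2
    constructor
    · rintro ⟨x, rfl⟩
      obtain ⟨y, rfl⟩ := sur₀ x
      obtain ⟨w, hw⟩ := (ex₁ (b - b₀ y)).mp (by rw [map_sub, h1, hp₀, sub_self])
      refine ⟨w, inj₂ ?_⟩
      rw [hi₁, hw, map_sub, h2, (hb₁ (b₀ y)).mpr ⟨y, rfl⟩, sub_zero]
    · rintro ⟨w, rfl⟩
      obtain ⟨y, hy⟩ := (hb₁ (b - i₁ w)).mp (by rw [map_sub, h2, hi₁, sub_self])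
      refine ⟨p₀ y, ?_⟩
      rw [← hp₀, hy, map_sub, h1, (ex₁ (i₁ w)).mpr ⟨w, rfl⟩, sub_zero]

end Subquotient

namespace HigherLimits

variable {C : Type u} [SmallCategory C]

/-! ### The bar complex in low degrees -/

section LowDegrees

variable (G : Cᵒᵖ ⥤ AddCommGrpCat.{u})

/-- `0`-cochains. -/
abbrev Cochain₀ : Type u := ∀ P : C, G.obj (op P)

/-- The coboundary from `0`-cochains to `1`-cochains. -/
def d₀ : Cochain₀ G →+ Cochain₁ G where
  toFun c P Q f := G.map f.op (c Q) - c P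
  map_zero' := by
    funext P Q f
    simp
  map_add' c c' := by
    funext P Q f
    simp only [Pi.add_apply, map_add]
    abel

/-- Compatible families of elements. -/
abbrev Sections : AddSubgroup (Cochain₀ G) := (d₀ G).ker

variable {G}

theorem Sections.map_eq (s : Sections G) {P Q : C} (f : P ⟶ Q) :
    G.map f.op (s.1 Q) = s.1 P :=
  sub_eq_zero.mp (congrFun (congrFun (congrFun s.2 P) Q) f)

theorem map_comp_apply {P Q R : C} (f : P ⟶ Q) (g : Q ⟶ R) (x : G.obj (op R)) :
    G.map (f ≫ g).op x = G.map f.op (G.map g.op x) := by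
  simp

theorem d₁_d₀ (c : Cochain₀ G) : d₁ G (d₀ G c) = 0 := by
  funext P Q R f g
  simp only [d₁, d₀, AddMonoidHom.coe_mk, ZeroHom.coe_mk, map_sub, map_comp_apply, Pi.zero_apply]
  abel

theorem d₂_d₁ (c : Cochain₁ G) : d₂ G (d₁ G c) = 0 := by
  funext P Q R T f g h
  simp only [d₁, d₂, AddMonoidHom.coe_mk, ZeroHom.coe_mk, map_sub, map_add, map_comp_apply,
    Pi.zero_apply, Category.assoc]
  abel

theorem d₃_d₂ (c : Cochain₂ G) : d₃ G (d₂ G c) = 0 := by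
  funext P Q R T U f g h k
  simp only [d₃, d₂, AddMonoidHom.coe_mk, ZeroHom.coe_mk, map_sub, map_add, map_comp_apply,
    Pi.zero_apply, Category.assoc]
  abel

end LowDegrees

/-! ### Naturality of the coboundaries -/

section Naturality

variable {G H : Cᵒᵖ ⥤ AddCommGrpCat.{u}} (φ : G ⟶ H)

/-- The map on `0`-cochains induced by a natural transformation. -/
def mapCochain₀ : Cochain₀ G →+ Cochain₀ H where
  toFun c P := φ.app _ (c P)
  map_zero' := by funext P; simp
  map_add' c c' := by funext P; simp

/-- The map on `1`-cochains induced by a natural transformation. -/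
def mapCochain₁ : Cochain₁ G →+ Cochain₁ H where
  toFun c P Q f := φ.app _ (c P Q f)
  map_zero' := by funext P Q f; simp
  map_add' c c' := by funext P Q f; simp

/-- The map on `2`-cochains induced by a natural transformation. -/
def mapCochain₂ : Cochain₂ G →+ Cochain₂ H where
  toFun c P Q R f g := φ.app _ (c P Q R f g)
  map_zero' := by funext P Q R f g; simp
  map_add' c c' := by funext P Q R f g; simp

/-- The map on `3`-cochains induced by a natural transformation. -/
def mapCochain₃ : Cochain₃ G →+ Cochain₃ H where
  toFun c P Q R T f g h := φ.app _ (c P Q R T f g h)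
  map_zero' := by funext P Q R T f g h; simp
  map_add' c c' := by funext P Q R T f g h; simp

/-- The map on `4`-cochains induced by a natural transformation. -/
def mapCochain₄ : Cochain₄ G →+ Cochain₄ H where
  toFun c P Q R T U f g h k := φ.app _ (c P Q R T U f g h k)
  map_zero' := by funext P Q R T U f g h k; simp
  map_add' c c' := by funext P Q R T U f g h k; simp

theorem map_d₀ (c : Cochain₀ G) : mapCochain₁ φ (d₀ G c) = d₀ H (mapCochain₀ φ c) := by
  funext P Q f
  simp [d₀, mapCochain₀, mapCochain₁]

theorem map_d₁ (c : Cochain₁ G) : mapCochain₂ φ (d₁ G c) = d₁ H (mapCochain₁ φ c) := by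
  funext P Q R f g
  simp [d₁, mapCochain₁, mapCochain₂]

theorem map_d₂ (c : Cochain₂ G) : mapCochain₃ φ (d₂ G c) = d₂ H (mapCochain₂ φ c) := by
  funext P Q R T f g h
  simp [d₂, mapCochain₂, mapCochain₃]

theorem map_d₃ (c : Cochain₃ G) : mapCochain₄ φ (d₃ G c) = d₃ H (mapCochain₃ φ c) := by
  funext P Q R T U f g h k
  simp [d₃, mapCochain₃, mapCochain₄]

end Naturality

/-! ### Injective functors are acyclic for the bar complex -/

section Acyclic

variable (G : Cᵒᵖ ⥤ AddCommGrpCat.{u})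

/-- The coinduced functor, with value `∏_{Q → P} G(Q)` at `P`. -/
def coinduced : Cᵒᵖ ⥤ AddCommGrpCat.{u} where
  obj P := AddCommGrpCat.of (∀ Q : C, (Q ⟶ P.unop) → G.obj (op Q))
  map f := AddCommGrpCat.ofHom
    { toFun := fun m Q e => m Q (e ≫ f.unop)
      map_zero' := rfl
      map_add' := fun _ _ => rfl }
  map_id P := by
    ext m Q e
    exact congrArg (m Q) (Category.comp_id e)
  map_comp f g := by
    ext m Q e
    exact congrArg (m Q) (Category.assoc e g.unop f.unop).symm

/-- The canonical embedding of a functor in the coinduced one. -/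
def toCoinduced : G ⟶ coinduced G where
  app P := AddCommGrpCat.ofHom
    { toFun := fun x _ e => G.map e.op x
      map_zero' := by funext Q e; simp
      map_add' := fun x y => by funext Q e; simp }
  naturality P P' f := by
    ext x
    funext Q e
    exact (map_comp_apply e f.unop x).symm

instance : Mono (toCoinduced G) := by
  have : ∀ P, Mono ((toCoinduced G).app P) := by
    intro P
    rw [AddCommGrpCat.mono_iff_injective]
    intro x y h
    have h1 : G.map (𝟙 P.unop).op x = G.map (𝟙 P.unop).op y := congrFun (congrFun h P.unop) (𝟙 _)
    simpa using h1
  exact NatTrans.mono_of_mono_app _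

variable {G}

/-- A contracting homotopy prepends an arrow `e : A ⟶ P` to a chain and evaluates the resulting
cochain at `𝟙 A`. The cocycle identity for the lengthened chain, evaluated at `𝟙 A`, is the required
equation. The same homotopy works in degrees two and three. -/
theorem coinduced_exact₁ {c : Cochain₁ (coinduced G)} (hc : d₁ _ c = 0) : ∃ b, d₀ _ b = c := by
  refine ⟨fun P A e => (c A P e : ∀ Q : C, (Q ⟶ A) → G.obj (op Q)) A (𝟙 A), ?_⟩
  funext P Q f
  funext A e
  have h := congrFun (congrFun (congrFun (congrFun (congrFun (congrFun (congrFun hc A) P) Q) e) f)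
    A) (𝟙 A)
  have h' : (c P Q f : ∀ B : C, (B ⟶ P) → G.obj (op B)) A (𝟙 A ≫ e)
    - (c A Q (e ≫ f) : ∀ B : C, (B ⟶ A) → G.obj (op B)) A (𝟙 A)
    + (c A P e : ∀ B : C, (B ⟶ A) → G.obj (op B)) A (𝟙 A) = 0 := h
  rw [Category.id_comp] at h'
  change (c A Q (e ≫ f) : ∀ B : C, (B ⟶ A) → G.obj (op B)) A (𝟙 A)
    - (c A P e : ∀ B : C, (B ⟶ A) → G.obj (op B)) A (𝟙 A) =
    (c P Q f : ∀ B : C, (B ⟶ P) → G.obj (op B)) A e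
  rw [← sub_eq_zero, ← neg_eq_zero, ← h']
  abel

theorem coinduced_exact₂ {c : Cochain₂ (coinduced G)} (hc : d₂ _ c = 0) : ∃ b, d₁ _ b = c := by
  refine ⟨fun P Q f A e => (c A P Q e f : ∀ Q : C, (Q ⟶ A) → G.obj (op Q)) A (𝟙 A), ?_⟩
  funext P Q R f g
  funext A e
  have h := congrFun (congrFun (congrFun (congrFun (congrFun (congrFun (congrFun (congrFun
    (congrFun hc A) P) Q) R) e) f) g) A) (𝟙 A)
  have h' : (c P Q R f g : ∀ B : C, (B ⟶ P) → G.obj (op B)) A (𝟙 A ≫ e)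
    - (c A Q R (e ≫ f) g : ∀ B : C, (B ⟶ A) → G.obj (op B)) A (𝟙 A)
    + (c A P R e (f ≫ g) : ∀ B : C, (B ⟶ A) → G.obj (op B)) A (𝟙 A)
    - (c A P Q e f : ∀ B : C, (B ⟶ A) → G.obj (op B)) A (𝟙 A) = 0 := h
  rw [Category.id_comp] at h'
  change (c A Q R (e ≫ f) g : ∀ B : C, (B ⟶ A) → G.obj (op B)) A (𝟙 A)
    - (c A P R e (f ≫ g) : ∀ B : C, (B ⟶ A) → G.obj (op B)) A (𝟙 A)
    + (c A P Q e f : ∀ B : C, (B ⟶ A) → G.obj (op B)) A (𝟙 A) =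
    (c P Q R f g : ∀ B : C, (B ⟶ P) → G.obj (op B)) A e
  rw [← sub_eq_zero, ← neg_eq_zero, ← h']
  abel

theorem coinduced_exact₃ {c : Cochain₃ (coinduced G)} (hc : d₃ _ c = 0) : ∃ b, d₂ _ b = c := by
  refine ⟨fun P Q R f g A e => (c A P Q R e f g : ∀ Q : C, (Q ⟶ A) → G.obj (op Q)) A (𝟙 A), ?_⟩
  funext P Q R T f g k
  funext A e
  have h := congrFun (congrFun (congrFun (congrFun (congrFun (congrFun (congrFun (congrFun
    (congrFun (congrFun (congrFun hc A) P) Q) R) T) e) f) g) k) A) (𝟙 A)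
  have h' : (c P Q R T f g k : ∀ B : C, (B ⟶ P) → G.obj (op B)) A (𝟙 A ≫ e)
    - (c A Q R T (e ≫ f) g k : ∀ B : C, (B ⟶ A) → G.obj (op B)) A (𝟙 A)
    + (c A P R T e (f ≫ g) k : ∀ B : C, (B ⟶ A) → G.obj (op B)) A (𝟙 A)
    - (c A P Q T e f (g ≫ k) : ∀ B : C, (B ⟶ A) → G.obj (op B)) A (𝟙 A)
    + (c A P Q R e f g : ∀ B : C, (B ⟶ A) → G.obj (op B)) A (𝟙 A) = 0 := h
  rw [Category.id_comp] at h'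
  change (c A Q R T (e ≫ f) g k : ∀ B : C, (B ⟶ A) → G.obj (op B)) A (𝟙 A)
    - (c A P R T e (f ≫ g) k : ∀ B : C, (B ⟶ A) → G.obj (op B)) A (𝟙 A)
    + (c A P Q T e f (g ≫ k) : ∀ B : C, (B ⟶ A) → G.obj (op B)) A (𝟙 A)
    - (c A P Q R e f g : ∀ B : C, (B ⟶ A) → G.obj (op B)) A (𝟙 A) =
    (c P Q R T f g k : ∀ B : C, (B ⟶ P) → G.obj (op B)) A e
  rw [← sub_eq_zero, ← neg_eq_zero, ← h']
  abel

/-- The retraction of the canonical embedding of an injective functor. -/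
theorem exists_retraction (G : Cᵒᵖ ⥤ AddCommGrpCat.{u}) [Injective G] :
    ∃ r : coinduced G ⟶ G, ∀ (P : Cᵒᵖ) (x : G.obj P), r.app P ((toCoinduced G).app P x) = x := by
  refine ⟨Injective.factorThru (𝟙 G) (toCoinduced G), fun P x => ?_⟩
  have h := Injective.comp_factorThru (𝟙 G) (toCoinduced G)
  exact ConcreteCategory.congr_hom (congrArg (fun k => NatTrans.app k P) h) x

variable [Injective G]

/-- Exactness passes from the coinduced functor to its retract: push the cocycle forward, solve
there, and retract the solution. -/
theorem injective_exact₁ (c : Cochain₁ G) : d₁ _ c = 0 ↔ ∃ b, d₀ _ b = c := by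
  refine ⟨fun hc => ?_, fun ⟨b, hb⟩ => hb ▸ d₁_d₀ b⟩
  obtain ⟨r, hr⟩ := exists_retraction G
  obtain ⟨b, hb⟩ := coinduced_exact₁ (c := mapCochain₁ (toCoinduced G) c)
    (by rw [← map_d₁, hc, map_zero])
  refine ⟨mapCochain₀ r b, ?_⟩
  rw [← map_d₀, hb]
  funext P Q f
  exact hr _ _

theorem injective_exact₂ (c : Cochain₂ G) : d₂ _ c = 0 ↔ ∃ b, d₁ _ b = c := by
  refine ⟨fun hc => ?_, fun ⟨b, hb⟩ => hb ▸ d₂_d₁ b⟩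
  obtain ⟨r, hr⟩ := exists_retraction G
  obtain ⟨b, hb⟩ := coinduced_exact₂ (c := mapCochain₂ (toCoinduced G) c)
    (by rw [← map_d₂, hc, map_zero])
  refine ⟨mapCochain₁ r b, ?_⟩
  rw [← map_d₁, hb]
  funext P Q R f g
  exact hr _ _

theorem injective_exact₃ (c : Cochain₃ G) : d₃ _ c = 0 ↔ ∃ b, d₂ _ b = c := by
  refine ⟨fun hc => ?_, fun ⟨b, hb⟩ => hb ▸ d₃_d₂ b⟩
  obtain ⟨r, hr⟩ := exists_retraction G
  obtain ⟨b, hb⟩ := coinduced_exact₃ (c := mapCochain₃ (toCoinduced G) c)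
    (by rw [← map_d₃, hc, map_zero])
  refine ⟨mapCochain₂ r b, ?_⟩
  rw [← map_d₂, hb]
  funext P Q R T f g h
  exact hr _ _

end Acyclic

end HigherLimits

namespace HigherLimits

variable {C : Type u} [SmallCategory C]

/-! ### Dimension shifting -/

section Shift

variable {A B D : Cᵒᵖ ⥤ AddCommGrpCat.{u}} {i : A ⟶ B} {p : B ⟶ D}

/-- Objectwise short exactness of `A → B → D`, in terms of elements. -/
structure ObjwiseExact (i : A ⟶ B) (p : B ⟶ D) : Prop where
  injective (P : Cᵒᵖ) : Function.Injective (i.app P)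
  surjective (P : Cᵒᵖ) : Function.Surjective (p.app P)
  exact (P : Cᵒᵖ) (b : B.obj P) : p.app P b = 0 ↔ ∃ a, i.app P a = b

theorem ObjwiseExact.of_shortExact {S : ShortComplex (Cᵒᵖ ⥤ AddCommGrpCat.{u})}
    (hS : S.ShortExact) : ObjwiseExact S.f S.g := by
  have h (P : Cᵒᵖ) := hS.map_of_exact ((evaluation Cᵒᵖ AddCommGrpCat.{u}).obj P)
  refine ⟨fun P => (h P).ab_injective_f, fun P => (h P).ab_surjective_g, fun P b => ?_⟩
  refine ⟨fun hb => (ShortComplex.ab_exact_iff _).mp (h P).exact b hb, ?_⟩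
  rintro ⟨a, rfl⟩
  exact ShortComplex.ab_zero_apply (S.map ((evaluation Cᵒᵖ AddCommGrpCat.{u}).obj P)) a

variable (h : ObjwiseExact i p)
include h

theorem ObjwiseExact.injective₁ : Function.Injective (mapCochain₁ i) := fun _ _ e =>
  funext fun P => funext fun Q => funext fun f => h.injective _
    (congrFun (congrFun (congrFun e P) Q) f)

theorem ObjwiseExact.injective₂ : Function.Injective (mapCochain₂ i) := fun _ _ e =>
  funext fun P => funext fun Q => funext fun R => funext fun f => funext fun g => h.injective _
    (congrFun (congrFun (congrFun (congrFun (congrFun e P) Q) R) f) g)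

theorem ObjwiseExact.injective₃ : Function.Injective (mapCochain₃ i) := fun _ _ e =>
  funext fun P => funext fun Q => funext fun R => funext fun T => funext fun f => funext fun g =>
    funext fun k => h.injective _ (congrFun (congrFun (congrFun (congrFun (congrFun (congrFun
      (congrFun e P) Q) R) T) f) g) k)

theorem ObjwiseExact.injective₄ : Function.Injective (mapCochain₄ i) := fun _ _ e =>
  funext fun P => funext fun Q => funext fun R => funext fun T => funext fun U =>
    funext fun f => funext fun g => funext fun k => funext fun l => h.injective _
      (congrFun (congrFun (congrFun (congrFun (congrFun (congrFun (congrFun (congrFun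
        (congrFun e P) Q) R) T) U) f) g) k) l)

theorem ObjwiseExact.surjective₀ : Function.Surjective (mapCochain₀ p) := fun c =>
  ⟨fun P => (h.surjective _ (c P)).choose, funext fun P => (h.surjective _ (c P)).choose_spec⟩

theorem ObjwiseExact.surjective₁ : Function.Surjective (mapCochain₁ p) := fun c =>
  ⟨fun P Q f => (h.surjective _ (c P Q f)).choose,
    funext fun P => funext fun Q => funext fun f => (h.surjective _ (c P Q f)).choose_spec⟩

theorem ObjwiseExact.surjective₂ : Function.Surjective (mapCochain₂ p) := fun c =>
  ⟨fun P Q R f g => (h.surjective _ (c P Q R f g)).choose,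
    funext fun P => funext fun Q => funext fun R => funext fun f => funext fun g =>
      (h.surjective _ (c P Q R f g)).choose_spec⟩

theorem ObjwiseExact.app_app {P : Cᵒᵖ} (a : A.obj P) : p.app P (i.app P a) = 0 :=
  (h.exact P _).mpr ⟨a, rfl⟩

theorem ObjwiseExact.exact₀ (c : Cochain₀ B) :
    mapCochain₀ p c = 0 ↔ ∃ a, mapCochain₀ i a = c := by
  constructor
  · intro hc
    have hc' (P) : ∃ a, i.app _ a = c P := (h.exact _ _).mp (congrFun hc P)
    choose a ha using hc'
    exact ⟨a, funext ha⟩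
  · rintro ⟨a, rfl⟩
    exact funext fun P => h.app_app _

theorem ObjwiseExact.exact₁ (c : Cochain₁ B) :
    mapCochain₁ p c = 0 ↔ ∃ a, mapCochain₁ i a = c := by
  constructor
  · intro hc
    have hc' (P Q f) : ∃ a, i.app _ a = c P Q f :=
      (h.exact _ _).mp (congrFun (congrFun (congrFun hc P) Q) f)
    choose a ha using hc'
    exact ⟨a, funext fun P => funext fun Q => funext (ha P Q)⟩
  · rintro ⟨a, rfl⟩
    exact funext fun P => funext fun Q => funext fun f => h.app_app _

theorem ObjwiseExact.exact₂ (c : Cochain₂ B) :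
    mapCochain₂ p c = 0 ↔ ∃ a, mapCochain₂ i a = c := by
  constructor
  · intro hc
    have hc' (P Q R f g) : ∃ a, i.app _ a = c P Q R f g :=
      (h.exact _ _).mp (congrFun (congrFun (congrFun (congrFun (congrFun hc P) Q) R) f) g)
    choose a ha using hc'
    exact ⟨a, funext fun P => funext fun Q => funext fun R => funext fun f => funext (ha P Q R f)⟩
  · rintro ⟨a, rfl⟩
    exact funext fun P => funext fun Q => funext fun R => funext fun f => funext fun g =>
      h.app_app _

variable [Injective B]

/-- The first cohomology group of the bar complex. -/
abbrev BarH₁ (G : Cᵒᵖ ⥤ AddCommGrpCat.{u}) : Type u :=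
  (d₁ G).ker ⧸ (d₀ G).range.addSubgroupOf (d₁ G).ker

/-- The lowest connecting map. In the middle complex, degree zero is preceded by the sections of
`B`, so that exactness there holds by definition; the same group, with the identity map, serves as
the lowest term over `D`. -/
theorem ObjwiseExact.sections_equiv_barH₁ :
    Nonempty (Sections D ⧸ ((mapCochain₀ p).comp (Sections B).subtype).range.addSubgroupOf
      (Sections D) ≃+ BarH₁ A) :=
  nonempty_connecting_equiv (d₀ A) (d₁ A) (Sections B).subtype (d₀ B) (d₁ B)
    ((mapCochain₀ p).comp (Sections B).subtype) (d₀ D)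
    (mapCochain₀ i) (mapCochain₁ i) (mapCochain₂ i)
    (AddMonoidHom.id _) (mapCochain₀ p) (mapCochain₁ p)
    (map_d₀ i) (map_d₁ i) (fun _ => rfl) (map_d₀ p)
    h.injective₁ h.injective₂ Function.surjective_id h.surjective₀ h.exact₀ h.exact₁
    (fun x => ⟨fun hx => ⟨⟨x, hx⟩, rfl⟩, fun ⟨y, hy⟩ => hy ▸ y.2⟩) injective_exact₁

theorem ObjwiseExact.barH₁_equiv_barH₂ : Nonempty (BarH₁ D ≃+ BarH₂ A) :=
  nonempty_connecting_equiv (d₁ A) (d₂ A) (d₀ B) (d₁ B) (d₂ B) (d₀ D) (d₁ D)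
    (mapCochain₁ i) (mapCochain₂ i) (mapCochain₃ i)
    (mapCochain₀ p) (mapCochain₁ p) (mapCochain₂ p)
    (map_d₁ i) (map_d₂ i) (map_d₀ p) (map_d₁ p)
    h.injective₂ h.injective₃ h.surjective₀ h.surjective₁ h.exact₁ h.exact₂
    injective_exact₁ injective_exact₂

theorem ObjwiseExact.barH₂_equiv_barH₃ : Nonempty (BarH₂ D ≃+ BarH₃ A) :=
  nonempty_connecting_equiv (d₂ A) (d₃ A) (d₁ B) (d₂ B) (d₃ B) (d₁ D) (d₂ D)
    (mapCochain₂ i) (mapCochain₃ i) (mapCochain₄ i)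
    (mapCochain₁ p) (mapCochain₂ p) (mapCochain₃ p)
    (map_d₂ i) (map_d₃ i) (map_d₁ p) (map_d₂ p)
    h.injective₃ h.injective₄ h.surjective₁ h.surjective₂ h.exact₂
    (fun c => by
      constructor
      · intro hc
        have hc' (P Q R T f g k) : ∃ a, i.app _ a = c P Q R T f g k :=
          (h.exact _ _).mp (congrFun (congrFun (congrFun (congrFun (congrFun (congrFun
            (congrFun hc P) Q) R) T) f) g) k)
        choose a ha using hc'
        exact ⟨a, funext fun P => funext fun Q => funext fun R => funext fun T => funext fun f =>
          funext fun g => funext (ha P Q R T f g)⟩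
      · rintro ⟨a, rfl⟩
        exact funext fun P => funext fun Q => funext fun R => funext fun T => funext fun f =>
          funext fun g => funext fun k => h.app_app _)
    injective_exact₂ injective_exact₃

end Shift

/-! ### Derived limits -/

section Limits

/-- The compatible family underlying an element of the limit. -/
noncomputable def limValue {G : Cᵒᵖ ⥤ AddCommGrpCat.{u}}
    (x : (Limits.lim : (Cᵒᵖ ⥤ AddCommGrpCat.{u}) ⥤ AddCommGrpCat.{u}).obj G) : Cochain₀ G :=
  fun P => Limits.limit.π G (op P) x

theorem limValue_mem {G : Cᵒᵖ ⥤ AddCommGrpCat.{u}}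
    (x : (Limits.lim : (Cᵒᵖ ⥤ AddCommGrpCat.{u}) ⥤ AddCommGrpCat.{u}).obj G) :
    limValue x ∈ Sections G := by
  funext P Q f
  exact sub_eq_zero.mpr (ConcreteCategory.congr_hom (Limits.limit.w G f.op) x)

theorem exists_limValue {G : Cᵒᵖ ⥤ AddCommGrpCat.{u}} (s : Sections G) :
    ∃ x : (Limits.lim : (Cᵒᵖ ⥤ AddCommGrpCat.{u}) ⥤ AddCommGrpCat.{u}).obj G,
      limValue x = s.1 := by
  let c : Limits.Cone G :=
    { pt := AddCommGrpCat.of (Sections G)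
      π :=
        { app := fun P => AddCommGrpCat.ofHom
            ((Pi.evalAddMonoidHom _ P.unop).comp (Sections G).subtype)
          naturality := fun P Q f => by
            ext s
            exact (Sections.map_eq s f.unop).symm } }
  refine ⟨Limits.limit.lift G c s, ?_⟩
  funext P
  exact ConcreteCategory.congr_hom (Limits.limit.lift_π c (op P)) s

theorem limValue_injective {G : Cᵒᵖ ⥤ AddCommGrpCat.{u}} : Function.Injective
    (limValue (G := G)) := by
  intro x y hxy
  exact Limits.Concrete.limit_ext G x y fun P => congrFun hxy P.unop

theorem limValue_map {G H : Cᵒᵖ ⥤ AddCommGrpCat.{u}} (φ : G ⟶ H)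
    (x : (Limits.lim : (Cᵒᵖ ⥤ AddCommGrpCat.{u}) ⥤ AddCommGrpCat.{u}).obj G) :
    limValue (Limits.lim.map φ x) = mapCochain₀ φ (limValue x) := by
  funext P
  exact ConcreteCategory.congr_hom (Limits.limMap_π φ (op P)) x

theorem limValue_add {G : Cᵒᵖ ⥤ AddCommGrpCat.{u}}
    (x y : (Limits.lim : (Cᵒᵖ ⥤ AddCommGrpCat.{u}) ⥤ AddCommGrpCat.{u}).obj G) :
    limValue (x + y) = limValue x + limValue y :=
  funext fun P => map_add (Limits.limit.π G (op P)).hom x y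

theorem limValue_zero {G : Cᵒᵖ ⥤ AddCommGrpCat.{u}} :
    limValue (0 : (Limits.lim : (Cᵒᵖ ⥤ AddCommGrpCat.{u}) ⥤ AddCommGrpCat.{u}).obj G) = 0 :=
  funext fun P => map_zero (Limits.limit.π G (op P)).hom

theorem limValue_neg {G : Cᵒᵖ ⥤ AddCommGrpCat.{u}}
    (x : (Limits.lim : (Cᵒᵖ ⥤ AddCommGrpCat.{u}) ⥤ AddCommGrpCat.{u}).obj G) :
    limValue (-x) = -limValue x :=
  funext fun P => map_neg (Limits.limit.π G (op P)).hom x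

/-- The homology of the limits of `J₁ → J₂ → J₃` is the group of sections of the kernel `D` of
`J₂ → J₃` modulo the image of those of `J₁`. -/
theorem homology_lim_equiv (S : ShortComplex (Cᵒᵖ ⥤ AddCommGrpCat.{u}))
    {D : Cᵒᵖ ⥤ AddCommGrpCat.{u}} (p : S.X₁ ⟶ D) (j : D ⟶ S.X₂) (hpj : p ≫ j = S.f)
    (hj : ∀ P, Function.Injective (j.app P))
    (hex : ∀ (P : Cᵒᵖ) (x : S.X₂.obj P), S.g.app P x = 0 ↔ ∃ y, j.app P y = x) :
    Nonempty (Sections D ⧸ ((mapCochain₀ p).comp (Sections S.X₁).subtype).range.addSubgroupOf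
      (Sections D) ≃+ (S.map Limits.lim).homology) := by
  -- With homology written as kernel modulo image, it remains to relate a section of `D` to the
  -- element of the limit of `J₂` whose components are its image under `j`.
  suffices h : Nonempty (Sections D ⧸
      ((mapCochain₀ p).comp (Sections S.X₁).subtype).range.addSubgroupOf (Sections D) ≃+
      ((S.map Limits.lim).g.hom.ker ⧸ (S.map Limits.lim).abToCycles.range)) by
    obtain ⟨e⟩ := h
    exact ⟨e.trans (S.map Limits.lim).abHomologyIso.symm.addCommGroupIsoToAddEquiv⟩
  have hpj' (P : C) (x : S.X₁.obj (op P)) :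
      j.app _ (p.app _ x) = S.f.app _ x :=
    ConcreteCategory.congr_hom (congrArg (fun k => NatTrans.app k (op P)) hpj) x
  let R : AddSubgroup (Sections D × (S.map Limits.lim).g.hom.ker) :=
    { carrier := {x | limValue x.2.1 = mapCochain₀ j x.1.1}
      zero_mem' := limValue_zero.trans (map_zero _).symm
      add_mem' := fun {x y} hx hy => by
        have := limValue_add x.2.1 y.2.1
        exact this.trans ((congrArg₂ (· + ·) hx hy).trans (map_add (mapCochain₀ j) _ _).symm)
      neg_mem' := fun {x} hx => by
        have := limValue_neg x.2.1
        exact this.trans ((congrArg Neg.neg hx).trans (map_neg (mapCochain₀ j) _).symm) }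
  refine QuotientAddGroup.nonempty_equiv_of_relation _ _ R ?_ ?_ ?_
  · intro s
    obtain ⟨x, hx⟩ := exists_limValue (⟨mapCochain₀ j s.1, by
      rw [AddMonoidHom.mem_ker, ← map_d₀, show d₀ D s.1 = 0 from s.2, map_zero]⟩ :
      Sections S.X₂)
    refine ⟨⟨x, limValue_injective ?_⟩, hx⟩
    refine (limValue_map S.g x).trans (Eq.trans ?_ limValue_zero.symm)
    rw [hx]
    funext P
    exact (hex _ _).mpr ⟨_, rfl⟩
  · rintro ⟨x, hx⟩
    have h1 : mapCochain₀ S.g (limValue x) = 0 :=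
      (limValue_map S.g x).symm.trans ((congrArg limValue hx).trans limValue_zero)
    have h2 (P) : ∃ y, j.app _ y = limValue x P := (hex _ _).mp (congrFun h1 P)
    choose y hy using h2
    refine ⟨⟨y, ?_⟩, (funext hy).symm⟩
    funext P Q f
    apply hj
    have h3 : mapCochain₁ j (d₀ D y) = 0 := by
      rw [map_d₀, show mapCochain₀ j y = limValue x from funext hy]
      exact limValue_mem x
    exact (congrFun (congrFun (congrFun h3 P) Q) f).trans (map_zero _).symm
  · rintro ⟨s, hs⟩ ⟨x, hx⟩ (h : limValue x = mapCochain₀ j s)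
    constructor
    · rintro ⟨t, ht⟩
      obtain ⟨y, hy⟩ := exists_limValue t
      refine ⟨y, Subtype.ext (limValue_injective ?_)⟩
      refine (limValue_map S.f y).trans (Eq.trans ?_ h.symm)
      rw [hy]
      funext P
      refine (hpj' P _).symm.trans ?_
      exact congrArg (j.app (op P)) (congrFun ht P)
    · rintro ⟨y, hy⟩
      refine ⟨⟨limValue y, limValue_mem y⟩, funext fun P => hj _ ?_⟩
      refine (hpj' P _).trans ?_
      have h1 : Limits.lim.map S.f y = x := congrArg Subtype.val hy
      have h2 := congrFun (limValue_map S.f y) P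
      rw [h1, h] at h2
      exact h2.symm

variable {G : Cᵒᵖ ⥤ AddCommGrpCat.{u}} (I : InjectiveResolution G)

/-- The cocycles of an injective resolution. -/
noncomputable abbrev cosyzygy (n : ℕ) : Cᵒᵖ ⥤ AddCommGrpCat.{u} :=
  Limits.kernel (I.cocomplex.d n (n + 1))

/-- The map from an injective resolution to its cocycles. -/
noncomputable abbrev toCosyzygy (n : ℕ) : I.cocomplex.X n ⟶ cosyzygy I (n + 1) :=
  Limits.kernel.lift _ (I.cocomplex.d n (n + 1)) (I.cocomplex.d_comp_d _ _ _)

instance epi_toCosyzygy (n : ℕ) : Epi (toCosyzygy I n) :=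
  (I.exact_succ n).epi_kernelLift

/-- The corestriction of the differential to the next cocycles has the same kernel as the
differential, since the inclusion of cocycles is a monomorphism; it is onto because the resolution
is exact. -/
theorem cosyzygy_exact (n : ℕ) :
    ObjwiseExact (Limits.kernel.ι (I.cocomplex.d n (n + 1))) (toCosyzygy I n) := by
  have w : Limits.kernel.ι (I.cocomplex.d n (n + 1)) ≫ toCosyzygy I n = 0 := by
    rw [← cancel_mono (Limits.kernel.ι _)]
    simp
  refine ObjwiseExact.of_shortExact (S := ShortComplex.mk _ _ w)
    { exact := ?_, mono_f := inferInstance, epi_g := epi_toCosyzygy I n }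
  apply ShortComplex.exact_of_f_is_kernel
  exact Limits.isKernelOfComp _ (I.cocomplex.d n (n + 1)) (Limits.kernelIsKernel _) w
    (Limits.kernel.lift_ι _ _ _)

theorem augmentation_exact :
    ObjwiseExact (I.ι.f 0 : G ⟶ I.cocomplex.X 0) (toCosyzygy I 0) := by
  have w : (I.ι.f 0 : G ⟶ I.cocomplex.X 0) ≫ toCosyzygy I 0 = 0 := by
    rw [← cancel_mono (Limits.kernel.ι _), Category.assoc, Limits.kernel.lift_ι]
    exact I.ι_f_zero_comp_complex_d.trans Limits.zero_comp.symm
  refine ObjwiseExact.of_shortExact (S := ShortComplex.mk _ _ w)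
    { exact := ?_, mono_f := inferInstanceAs (Mono (I.ι.f 0)), epi_g := epi_toCosyzygy I 0 }
  apply ShortComplex.exact_of_f_is_kernel
  exact Limits.isKernelOfComp _ (I.cocomplex.d 0 1) I.isLimitKernelFork w
    (Limits.kernel.lift_ι _ _ _)

theorem kernel_ι_app_injective {H K : Cᵒᵖ ⥤ AddCommGrpCat.{u}} (φ : H ⟶ K) (P : Cᵒᵖ) :
    Function.Injective ((Limits.kernel.ι φ).app P) := by
  rw [← AddCommGrpCat.mono_iff_injective]
  infer_instance

theorem app_eq_zero_iff {H K : Cᵒᵖ ⥤ AddCommGrpCat.{u}} (φ : H ⟶ K) (P : Cᵒᵖ) (x : H.obj P) :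
    φ.app P x = 0 ↔ ∃ y, (Limits.kernel.ι φ).app P y = x := by
  have h : (ShortComplex.mk _ _ (Limits.kernel.condition φ)).Exact :=
    ShortComplex.exact_of_f_is_kernel _ (Limits.kernelIsKernel _)
  have h' := h.map ((evaluation Cᵒᵖ AddCommGrpCat.{u}).obj P)
  refine ⟨fun hx => (ShortComplex.ab_exact_iff _).mp h' x hx, ?_⟩
  rintro ⟨a, rfl⟩
  exact ConcreteCategory.congr_hom
    (congrArg (fun k => NatTrans.app k P) (Limits.kernel.condition φ)) a

/-- The derived limit is the homology of the limits of the resolution, that is, sections of the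
cocycles in degree `n + 1` modulo those coming from `I^n`. The lowest connecting map for
`cosyzygy_exact` identifies this with `BarH₁`. -/
theorem higherLim_equiv_barH₁ (n : ℕ) :
    Nonempty (BarH₁ (cosyzygy I n) ≃+ higherLim (n + 1) G) := by
  obtain ⟨e₁⟩ := (cosyzygy_exact I n).sections_equiv_barH₁
  obtain ⟨e₂⟩ := homology_lim_equiv (I.cocomplex.sc' n (n + 1) (n + 2)) (toCosyzygy I n)
    (Limits.kernel.ι _) (Limits.kernel.lift_ι _ _ _) (kernel_ι_app_injective _) (app_eq_zero_iff _)
  let K := ((Limits.lim : (Cᵒᵖ ⥤ AddCommGrpCat.{u}) ⥤ AddCommGrpCat.{u}).mapHomologicalComplex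
    (ComplexShape.up ℕ)).obj I.cocomplex
  let e₃ : K.homology (n + 1) ≅ (K.sc' n (n + 1) (n + 2)).homology :=
    ShortComplex.homologyMapIso (K.isoSc' n (n + 1) (n + 2) (by simp) (by simp))
  exact ⟨e₁.symm.trans (e₂.trans (e₃.symm.trans
    (I.isoRightDerivedObj Limits.lim (n + 1)).symm).addCommGroupIsoToAddEquiv)⟩

theorem barH₂_equiv_higherLim (G : Cᵒᵖ ⥤ AddCommGrpCat.{u}) :
    Nonempty (BarH₂ G ≃+ higherLim 2 G) := by
  let I := (HasInjectiveResolution.out (Z := G)).some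
  obtain ⟨e₁⟩ := (augmentation_exact I).barH₁_equiv_barH₂
  obtain ⟨e₂⟩ := higherLim_equiv_barH₁ I 1
  exact ⟨e₁.symm.trans e₂⟩

/-- Two dimension shifts, along the augmentation and then along the first cosyzygy, bring degree
three down to degree one. -/
theorem barH₃_equiv_higherLim (G : Cᵒᵖ ⥤ AddCommGrpCat.{u}) :
    Nonempty (BarH₃ G ≃+ higherLim 3 G) := by
  let I := (HasInjectiveResolution.out (Z := G)).some
  obtain ⟨e₀⟩ := (augmentation_exact I).barH₂_equiv_barH₃
  obtain ⟨e₁⟩ := (cosyzygy_exact I 1).barH₁_equiv_barH₂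
  obtain ⟨e₂⟩ := higherLim_equiv_barH₁ I 2
  exact ⟨e₀.symm.trans (e₁.symm.trans e₂)⟩

end Limits

end HigherLimits

namespace FusionSystem

open HigherLimits

variable {S : Type u} [Group S] {F : FusionSystem S} {X : Set (Subgroup S)}

/-! ### Elements of the functor `Z_F^X` -/

section CenterVal

variable {hX : F.IsClosedFamily X} {P Q R : F.OrbitCategory F.centric}

theorem centerVal_mem_center (x : (centerFunctor hX).obj (op P)) :
    centerVal x ∈ Subgroup.center P.obj :=
  (Additive.toMul (α := centerOn X P.obj) x).2.1

theorem centerVal_add (x y : (centerFunctor hX).obj (op P)) :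
    centerVal (x + y) = centerVal x * centerVal y := rfl

theorem centerVal_ext {x y : (centerFunctor hX).obj (op P)}
    (h : P.obj ∈ X → centerVal x = centerVal y) : x = y :=
  centerOn_ext (P := P.obj) (w := Additive.toMul (α := centerOn X P.obj) x)
    (w' := Additive.toMul (α := centerOn X P.obj) y) h

theorem eq_of_not_mem (hP : P.obj ∉ X) (x y : (centerFunctor hX).obj (op P)) : x = y :=
  centerVal_ext fun h => absurd h hP

theorem exists_centerVal_eq (hP : P.obj ∈ X) {z : P.obj} (hz : z ∈ Subgroup.center P.obj) :
    ∃ x : (centerFunctor hX).obj (op P), centerVal x = z :=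
  ⟨Additive.ofMul (⟨z, hz, fun h => absurd hP h⟩ : centerOn X P.obj), rfl⟩

theorem apply_centerVal_map (hP : P.obj ∈ X) (φ : F.Hom P.obj Q.obj)
    (x : (centerFunctor hX).obj (op Q)) :
    φ.1 (centerVal ((centerFunctor hX).map (F.orbitClass φ : P ⟶ Q).op x)) = centerVal x :=
  centerOnMap_spec hX φ (Additive.toMul (α := centerOn X Q.obj) x) hP

theorem apply_centerVal_map' (hP : P.obj ∈ X) {f : P ⟶ Q} {φ : F.Hom P.obj Q.obj}
    (h : F.orbitClass φ = f) (x : (centerFunctor hX).obj (op Q)) :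
    φ.1 (centerVal ((centerFunctor hX).map f.op x)) = centerVal x := by
  subst h
  exact apply_centerVal_map hP φ x

theorem orbitClass_homComp (φ : F.Hom P.obj Q.obj) (ψ : F.Hom Q.obj R.obj) :
    (F.orbitClass (F.homComp φ ψ) : P ⟶ R) =
      (F.orbitClass φ : P ⟶ Q) ≫ (F.orbitClass ψ : Q ⟶ R) := rfl

/-- An element which centralizes the image of a morphism from a centric subgroup `P` comes from the
center of `P`. -/
theorem exists_center_of_centralizes {P Q : Subgroup S} (hP : P ∈ F.centric) (φ : F.Hom P Q)
    (q : Q) (hq : ∀ x, q * φ.1 x = φ.1 x * q) : ∃ z ∈ Subgroup.center P, φ.1 z = q := by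
  obtain ⟨φ, hφ⟩ := φ
  obtain ⟨R, hR, e, he, he', rfl⟩ := F.exists_factor hφ
  have hqR : (q : S) ∈ R := by
    -- The image `R` is `F`-conjugate to `P`, so centricity of `P` forces the centralizer of `R`
    -- into `R`.
    apply hP R ⟨e, he, he'⟩
    rw [Subgroup.mem_centralizer_iff]
    intro x hx
    have := congrArg Subtype.val (hq (e.symm ⟨x, hx⟩))
    simpa using this.symm
  refine ⟨e.symm ⟨q, hqR⟩, ?_, by ext; simp⟩
  rw [Subgroup.mem_center_iff]
  intro x
  apply F.injective hφ
  have := hq x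
  simp only [map_mul]
  convert this.symm using 2 <;> (ext; simp)

end CenterVal

/-! ### Cochains supported on a closed family -/

section Extend

variable (hX : F.IsClosedFamily X)

/-- The value of `Z_F^X` at a member of `X`. -/
noncomputable abbrev ZAt (P : X) : AddCommGrpCat.{u} := (centerFunctor hX).obj (op (hX.toOrbit P))

variable {hX} in
/-- The element of `P` underlying an element of `Z_F^X(P)`, for `P ∈ X`. -/
def zval {P : X} (x : ZAt hX P) : P.1 := centerVal x

variable {hX} in
theorem zval_mem_center {P : X} (x : ZAt hX P) : zval x ∈ Subgroup.center P.1 :=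
  centerVal_mem_center x

variable {hX} in
theorem zval_comm {P : X} (x : ZAt hX P) (a : P.1) : a * zval x = zval x * a :=
  Subgroup.mem_center_iff.mp (zval_mem_center x) a

variable {hX} in
theorem zval_injective {P : X} : Function.Injective (zval (hX := hX) (P := P)) :=
  fun _ _ h => centerVal_ext fun _ => h

theorem exists_zval_eq {P : X} {z : P.1} (hz : z ∈ Subgroup.center P.1) :
    ∃ x : ZAt hX P, zval x = z :=
  exists_centerVal_eq (P := hX.toOrbit P) P.2 hz

variable {hX} in
theorem apply_zval_map {P Q : X} (φ : F.Hom P.1 Q.1) (x : ZAt hX Q) :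
    φ.1 (zval ((centerFunctor hX).map
      (F.orbitClass φ : hX.toOrbit P ⟶ hX.toOrbit Q).op x : ZAt hX P)) = zval x :=
  apply_centerVal_map (P := hX.toOrbit P) (Q := hX.toOrbit Q) P.2 φ x

open Classical in
/-- Extension by zero of a `1`-cochain. -/
noncomputable def extend₁ (c : ∀ P Q : X, (hX.toOrbit P ⟶ hX.toOrbit Q) → ZAt hX P) :
    Cochain₁ (centerFunctor hX) := fun P Q f =>
  if h : P.obj ∈ X ∧ Q.obj ∈ X then c ⟨P.obj, h.1⟩ ⟨Q.obj, h.2⟩ f else 0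

open Classical in
/-- Extension by zero of a `2`-cochain. -/
noncomputable def extend₂ (c : ∀ P Q R : X, (hX.toOrbit P ⟶ hX.toOrbit Q) →
    (hX.toOrbit Q ⟶ hX.toOrbit R) → ZAt hX P) :
    Cochain₂ (centerFunctor hX) := fun P Q R f g =>
  if h : P.obj ∈ X ∧ Q.obj ∈ X ∧ R.obj ∈ X then
    c ⟨P.obj, h.1⟩ ⟨Q.obj, h.2.1⟩ ⟨R.obj, h.2.2⟩ f g else 0

theorem extend₁_apply (c : ∀ P Q : X, (hX.toOrbit P ⟶ hX.toOrbit Q) → ZAt hX P) (P Q : X)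
    (f : hX.toOrbit P ⟶ hX.toOrbit Q) :
    extend₁ hX c (hX.toOrbit P) (hX.toOrbit Q) f = c P Q f :=
  dif_pos ⟨P.2, Q.2⟩

theorem extend₂_apply (c : ∀ P Q R : X, (hX.toOrbit P ⟶ hX.toOrbit Q) →
    (hX.toOrbit Q ⟶ hX.toOrbit R) → ZAt hX P) (P Q R : X)
    (f : hX.toOrbit P ⟶ hX.toOrbit Q) (g : hX.toOrbit Q ⟶ hX.toOrbit R) :
    extend₂ hX c (hX.toOrbit P) (hX.toOrbit Q) (hX.toOrbit R) f g = c P Q R f g :=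
  dif_pos ⟨P.2, Q.2, R.2⟩

variable {hX}

theorem mem_of_orbitHom {P Q : F.OrbitCategory F.centric} (f : P ⟶ Q) (hX : F.IsClosedFamily X)
    (hP : P.obj ∈ X) : Q.obj ∈ X :=
  mem_of_hom hX (Quotient.out f) hP

/-- A chain that starts in `X` stays in `X`, because `X` is closed under conjugacy and overgroups;
on a chain that starts elsewhere the values lie in the zero group. This is also why extension by
zero loses nothing. -/
theorem cochain₂_ext {c c' : Cochain₂ (centerFunctor hX)}
    (h : ∀ (P Q R : X) (f : hX.toOrbit P ⟶ hX.toOrbit Q) (g : hX.toOrbit Q ⟶ hX.toOrbit R),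
      c _ _ _ f g = c' _ _ _ f g) : c = c' := by
  funext P Q R f g
  by_cases hP : P.obj ∈ X
  · have hQ := mem_of_orbitHom f hX hP
    exact h ⟨P.obj, hP⟩ ⟨Q.obj, hQ⟩ ⟨R.obj, mem_of_orbitHom g hX hQ⟩ f g
  · exact eq_of_not_mem hP _ _

theorem cochain₃_ext {c c' : Cochain₃ (centerFunctor hX)}
    (h : ∀ (P Q R T : X) (f : hX.toOrbit P ⟶ hX.toOrbit Q) (g : hX.toOrbit Q ⟶ hX.toOrbit R)
      (k : hX.toOrbit R ⟶ hX.toOrbit T), c _ _ _ _ f g k = c' _ _ _ _ f g k) : c = c' := by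
  funext P Q R T f g k
  by_cases hP : P.obj ∈ X
  · have hQ := mem_of_orbitHom f hX hP
    have hR := mem_of_orbitHom g hX hQ
    exact h ⟨P.obj, hP⟩ ⟨Q.obj, hQ⟩ ⟨R.obj, hR⟩ ⟨T.obj, mem_of_orbitHom k hX hR⟩ f g k
  · exact eq_of_not_mem hP _ _

end Extend

/-! ### Calculus in linking systems -/

namespace LinkingSystem

variable (L : F.LinkingSystem X)

theorem δSelf_one (P : X) : L.δSelf P 1 = L.id P := L.δ_one P

theorem δSelf_mul (P : X) (a b : P.1) :
    L.δSelf P (a * b) = L.comp (L.δSelf P b) (L.δSelf P a) :=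
  L.δ_mul (P := P) ⟨b.1, mem_transporter_self b.2⟩ ⟨a.1, mem_transporter_self a.2⟩

theorem π_δSelf_apply (P : X) (a x : P.1) : (L.π (L.δSelf P a)).1 x = a * x * a⁻¹ := by
  rw [δSelf, π_δ]
  rfl

theorem π_comp_apply {P Q R : X} (f : L.Mor P Q) (g : L.Mor Q R) (x : P.1) :
    (L.π (L.comp f g)).1 x = (L.π g).1 ((L.π f).1 x) := by
  rw [π_comp]
  rfl

theorem δSelf_comp {P Q : X} (f : L.Mor P Q) (a : P.1) :
    L.comp (L.δSelf P a) f = L.comp f (L.δSelf Q ((L.π f).1 a)) :=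
  L.δ_comp f a

/-- Morphisms of `L` are monomorphisms: morphisms of `F` are injective, so `f` and `f'` agree in `F`
and differ by an element of `Z(P)`, which acts freely on the composite. -/
theorem comp_right_cancel {P Q R : X} {f f' : L.Mor P Q} {g : L.Mor Q R}
    (h : L.comp f g = L.comp f' g) : f = f' := by
  have hπ : L.π f = L.π f' := by
    apply Subtype.ext
    ext1 x
    apply F.injective (L.π g).2
    rw [← π_comp_apply, ← π_comp_apply, h]
  obtain ⟨z, hz, rfl⟩ := (L.π_eq_iff f f').mp hπ
  rw [assoc] at h
  have := L.free (L.comp f g) z hz h.symm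
  subst this
  exact ((congrArg (fun k => L.comp k f) (L.δSelf_one P)).trans (L.id_comp f)).symm

/-- Freeness of the action of `Q` on `Mor_L(P, Q)`. An element fixing `f` centralizes the image of
`π f`, hence by centricity comes from some `z ∈ Z(P)`; axiom (C) moves it to the source, where (A)
gives `z = 1`. -/
theorem comp_δSelf_injective (hX : F.IsClosedFamily X) {P Q : X} (f : L.Mor P Q) {a b : Q.1}
    (h : L.comp f (L.δSelf Q a) = L.comp f (L.δSelf Q b)) : a = b := by
  have h1 : L.comp f (L.δSelf Q (b⁻¹ * a)) = f := by
    rw [δSelf_mul, ← assoc, h, assoc, ← δSelf_mul, inv_mul_cancel, δSelf_one, comp_id]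
  obtain ⟨z, hz, hz'⟩ := exists_center_of_centralizes (hX.centric P.2) (L.π f) (b⁻¹ * a) (by
    intro x
    have h2 : (L.π (L.comp f (L.δSelf Q (b⁻¹ * a)))).1 x = (L.π f).1 x := by rw [h1]
    rw [π_comp_apply, π_δSelf_apply, mul_inv_eq_iff_eq_mul] at h2
    exact h2)
  rw [← hz', ← δSelf_comp] at h1
  rw [L.free f z hz h1, map_one] at hz'
  exact (inv_mul_eq_one.mp hz'.symm).symm

variable (hX : F.IsClosedFamily X)

/-- The automorphism of `P` given by an element of `Z(P)`. -/
def δCenter (P : X) (x : ZAt hX P) : L.Mor P P := L.δSelf P (zval x)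

theorem δCenter_zero (P : X) : L.δCenter hX P 0 = L.id P := L.δSelf_one P

theorem δCenter_add (P : X) (x y : ZAt hX P) :
    L.comp (L.δCenter hX P x) (L.δCenter hX P y) = L.δCenter hX P (x + y) := by
  rw [add_comm]
  exact (L.δSelf_mul P _ _).symm

theorem δCenter_add_assoc {P Q : X} (x y : ZAt hX P) (f : L.Mor P Q) :
    L.comp (L.δCenter hX P x) (L.comp (L.δCenter hX P y) f) =
      L.comp (L.δCenter hX P (x + y)) f := by
  rw [← assoc, δCenter_add]

/-- Axiom (C) for central elements. Moving them to the source applies the restriction map of the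
center functor, which produces the first term of the bar coboundary. -/
theorem comp_δCenter {P Q : X} (f : L.Mor P Q) (x : ZAt hX Q) :
    L.comp f (L.δCenter hX Q x) =
      L.comp (L.δCenter hX P ((centerFunctor hX).map (L.orbitMor hX f).op x)) f := by
  rw [δCenter, δCenter, δSelf_comp]
  congr 2
  exact (apply_zval_map (L.π f) x).symm

theorem comp_δCenter_assoc {P Q R : X} (f : L.Mor P Q) (x : ZAt hX Q) (g : L.Mor Q R) :
    L.comp f (L.comp (L.δCenter hX Q x) g) =
      L.comp (L.δCenter hX P ((centerFunctor hX).map (L.orbitMor hX f).op x)) (L.comp f g) := by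
  rw [← assoc, comp_δCenter, assoc]

theorem δCenter_comp_comp {P Q R : X} (x : ZAt hX P) (f : L.Mor P Q) (y : ZAt hX Q)
    (g : L.Mor Q R) :
    L.comp (L.comp (L.δCenter hX P x) f) (L.comp (L.δCenter hX Q y) g) =
      L.comp (L.δCenter hX P (x + (centerFunctor hX).map (L.orbitMor hX f).op y))
        (L.comp f g) := by
  rw [assoc, comp_δCenter_assoc, δCenter_add_assoc]

theorem π_δCenter_comp {P Q : X} (x : ZAt hX P) (f : L.Mor P Q) :
    L.π (L.comp (L.δCenter hX P x) f) = L.π f :=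
  ((L.π_eq_iff f _).mpr ⟨zval x, zval_mem_center x, rfl⟩).symm

theorem exists_δCenter_comp {P Q : X} {f f' : L.Mor P Q} (h : L.π f = L.π f') :
    ∃ x : ZAt hX P, f' = L.comp (L.δCenter hX P x) f := by
  obtain ⟨z, hz, rfl⟩ := (L.π_eq_iff f f').mp h
  obtain ⟨x, hx⟩ := exists_zval_eq hX hz
  refine ⟨x, ?_⟩
  rw [δCenter, hx]
  rfl

theorem δCenter_comp_injective {P Q : X} {x y : ZAt hX P} {f : L.Mor P Q}
    (h : L.comp (L.δCenter hX P x) f = L.comp (L.δCenter hX P y) f) : x = y := by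
  have h1 := L.comp_right_cancel h
  have h2 : L.comp (L.id P) (L.δSelf P (zval x)) =
      L.comp (L.id P) (L.δSelf P (zval y)) := by
    rw [id_comp, id_comp]
    exact h1
  exact zval_injective (L.comp_δSelf_injective hX (L.id P) h2)

theorem δSelf_comp_δCenter {P Q : X} (a : P.1) (x : ZAt hX P) (f : L.Mor P Q) :
    L.comp (L.δSelf P a) (L.comp (L.δCenter hX P x) f) =
      L.comp (L.δCenter hX P x) (L.comp (L.δSelf P a) f) := by
  rw [← assoc, ← assoc, δCenter, ← δSelf_mul, ← δSelf_mul]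
  congr 2
  exact (zval_comm x a).symm

theorem orbitMor_comp {P Q R : X} (f : L.Mor P Q) (g : L.Mor Q R) :
    L.orbitMor hX (L.comp f g) = L.orbitMor hX f ≫ L.orbitMor hX g := by
  rw [orbitMor, π_comp]
  rfl

theorem orbitMor_id (P : X) : L.orbitMor hX (L.id P) = 𝟙 _ := by
  rw [orbitMor, π_id]
  rfl

theorem orbitMor_eq_iff {P Q : X} {f f' : L.Mor P Q} :
    L.orbitMor hX f = L.orbitMor hX f' ↔ ∃ q : Q.1, ∀ x, (L.π f').1 x = q * (L.π f).1 x * q⁻¹ :=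
  ⟨fun h => Quotient.exact h, fun h => Quotient.sound h⟩

theorem orbitMor_comp_δSelf {P Q : X} (f : L.Mor P Q) (q : Q.1) :
    L.orbitMor hX (L.comp f (L.δSelf Q q)) = L.orbitMor hX f := by
  refine ((L.orbitMor_eq_iff hX).mpr ⟨q, fun x => ?_⟩).symm
  rw [π_comp_apply, π_δSelf_apply]

theorem orbitMor_δSelf_comp {P Q : X} (a : P.1) (f : L.Mor P Q) :
    L.orbitMor hX (L.comp (L.δSelf P a) f) = L.orbitMor hX f := by
  rw [δSelf_comp, orbitMor_comp_δSelf]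

theorem orbitMor_δSelf (P : X) (a : P.1) : L.orbitMor hX (L.δSelf P a) = 𝟙 _ := by
  rw [← L.comp_id (L.δSelf P a), orbitMor_δSelf_comp, orbitMor_id]

theorem orbitMor_surjective {P Q : X} (m : hX.toOrbit P ⟶ hX.toOrbit Q) :
    ∃ f : L.Mor P Q, L.orbitMor hX f = m := by
  obtain ⟨φ, rfl⟩ := Quotient.exists_rep m
  obtain ⟨f, rfl⟩ := L.π_surjective φ
  exact ⟨f, rfl⟩

/-- Together with `comp_δSelf_injective`, this makes each fibre of `Mor_L(P, Q)` over the orbit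
category a torsor under `Q`. -/
theorem exists_comp_δSelf {P Q : X} {f f' : L.Mor P Q}
    (h : L.orbitMor hX f = L.orbitMor hX f') : ∃ q, f' = L.comp f (L.δSelf Q q) := by
  obtain ⟨q, hq⟩ := (L.orbitMor_eq_iff hX).mp h
  have hπ : L.π (L.comp f (L.δSelf Q q)) = L.π f' := by
    apply Subtype.ext
    ext1 x
    rw [π_comp_apply, π_δSelf_apply, hq]
  obtain ⟨z, hz, rfl⟩ := (L.π_eq_iff _ _).mp hπ
  refine ⟨q * (L.π f).1 z, ?_⟩
  change L.comp (L.δSelf P z) (L.comp f (L.δSelf Q q)) = _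
  rw [δSelf_mul, ← assoc, ← assoc, δSelf_comp]

end LinkingSystem

end FusionSystem

namespace FusionSystem

open HigherLimits

variable {S : Type u} [Group S] {F : FusionSystem S} {X : Set (Subgroup S)}

/-! ### Constructing linking systems -/

/-- The data of a linking system in which the functor `δ` is only given on the groups `P ∈ X`. -/
structure PreLinkingSystem (F : FusionSystem S) (X : Set (Subgroup S)) where
  /-- the morphisms -/
  Mor : X → X → Type u
  comp {P Q R : X} : Mor P Q → Mor Q R → Mor P R
  assoc {P Q R T : X} (f : Mor P Q) (g : Mor Q R) (h : Mor R T) :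
    comp (comp f g) h = comp f (comp g h)
  /-- the functor to `F` -/
  π {P Q : X} : Mor P Q → F.Hom P.1 Q.1
  π_comp {P Q R : X} (f : Mor P Q) (g : Mor Q R) : π (comp f g) = F.homComp (π f) (π g)
  /-- the automorphisms given by the elements of `P` -/
  δ (P : X) : P.1 → Mor P P
  δ_mul (P : X) (a b : P.1) : δ P (a * b) = comp (δ P b) (δ P a)
  one_comp {P Q : X} (f : Mor P Q) : comp (δ P 1) f = f
  comp_one {P Q : X} (f : Mor P Q) : comp f (δ Q 1) = f
  π_surjective {P Q : X} : Function.Surjective (π : Mor P Q → F.Hom P.1 Q.1)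
  free {P Q : X} (f : Mor P Q) (z : P.1) (hz : z ∈ Subgroup.center P.1) :
    comp (δ P z) f = f → z = 1
  exists_of_π_eq {P Q : X} (f f' : Mor P Q) : π f = π f' →
    ∃ z : P.1, z ∈ Subgroup.center P.1 ∧ f' = comp (δ P z) f
  π_δ (P : X) (a x : P.1) : (π (δ P a)).1 x = a * x * a⁻¹
  δ_comp {P Q : X} (f : Mor P Q) (a : P.1) : comp (δ P a) f = comp f (δ Q ((π f).1 a))

namespace PreLinkingSystem

variable (L : F.PreLinkingSystem X)

theorem π_comp_apply {P Q R : X} (f : L.Mor P Q) (g : L.Mor Q R) (x : P.1) :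
    (L.π (L.comp f g)).1 x = (L.π g).1 ((L.π f).1 x) := by
  rw [π_comp]
  rfl

theorem comp_right_cancel {P Q R : X} {f f' : L.Mor P Q} {g : L.Mor Q R}
    (h : L.comp f g = L.comp f' g) : f = f' := by
  have hπ : L.π f = L.π f' := by
    apply Subtype.ext
    ext1 x
    apply F.injective (L.π g).2
    rw [← π_comp_apply, ← π_comp_apply, h]
  obtain ⟨z, hz, rfl⟩ := L.exists_of_π_eq f f' hπ
  rw [assoc] at h
  rw [L.free (L.comp f g) z hz h.symm, one_comp]

theorem π_center_comp {P Q : X} (f : L.Mor P Q) {z : P.1} (hz : z ∈ Subgroup.center P.1) :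
    L.π (L.comp (L.δ P z) f) = L.π f := by
  apply Subtype.ext
  ext1 x
  rw [π_comp_apply, π_δ, ← Subgroup.mem_center_iff.mp hz, mul_inv_cancel_right]

theorem π_δ_one (P : X) : L.π (L.δ P 1) = F.homId P.1 := by
  apply Subtype.ext
  ext1 x
  rw [π_δ]
  simp [homId]

theorem homConj_apply {P Q : Subgroup S} (g : transporter P Q) (x : P) :
    ((F.homConj g).1 x : S) = g.1 * x * g.1⁻¹ := rfl

/-- If `π f` and `π g` have the same target, a factorization of `π f` through `π g` in `F` lifts. -/
theorem exists_lift {P Q R : X} (f : L.Mor P R) (g : L.Mor Q R) (φ : F.Hom P.1 Q.1)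
    (h : ∀ x, (L.π g).1 (φ.1 x) = (L.π f).1 x) : ∃ m, L.π m = φ ∧ L.comp m g = f := by
  obtain ⟨m, rfl⟩ := L.π_surjective φ
  obtain ⟨z, hz, rfl⟩ := L.exists_of_π_eq (L.comp m g) f (by
    apply Subtype.ext
    ext1 x
    rw [π_comp_apply, h])
  exact ⟨L.comp (L.δ P z) m, L.π_center_comp m hz, L.assoc _ _ _⟩

/-- Choices of inclusions extend `δ` to the transporter category. -/
theorem exists_transporter_extension (hXne : X.Nonempty) (hX : F.IsClosedFamily X) :
    ∃ δ : ∀ {P Q : X}, transporter P.1 Q.1 → L.Mor P Q,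
      (∀ (P Q R : X) (g : transporter P.1 Q.1) (h : transporter Q.1 R.1),
        δ ⟨h.1 * g.1, mul_mem_transporter g.2 h.2⟩ = L.comp (δ g) (δ h)) ∧
      (∀ (P Q : X) (g : transporter P.1 Q.1), L.π (δ g) = F.homConj g) ∧
      (∀ (P : X) (a : P.1), δ ⟨a.1, mem_transporter_self a.2⟩ = L.δ P a) := by
  classical
  obtain ⟨P₀, hP₀⟩ := hXne
  let T : X := ⟨⊤, hX.overgroup_mem P₀ hP₀ ⊤ le_top⟩
  have hT (P : Subgroup S) : (1 : S) ∈ transporter P (⊤ : Subgroup S) := fun _ _ => trivial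
  obtain ⟨ι, hι, hιT⟩ : ∃ ι : ∀ P, L.Mor P T,
      (∀ P x, ((L.π (ι P)).1 x : S) = x) ∧ ι T = L.δ T 1 := by
    have h (P : X) := L.π_surjective (P := P) (Q := T) (F.homConj ⟨1, hT P.1⟩)
    choose ι hι using h
    refine ⟨Function.update ι T (L.δ T 1), fun P x => ?_, Function.update_self ..⟩
    by_cases hP : P = T
    · subst hP
      rw [Function.update_self, π_δ_one]
      rfl
    · rw [Function.update_of_ne hP, hι, homConj_apply]
      simp
  -- A lift of `c_g` is pinned down by its composite with the chosen inclusion of `Q` in `S`, which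
  -- has to be the inclusion of `P` followed by `g` as an automorphism of `S`. Cancelling inclusions
  -- then yields functoriality and agreement with the given `δ` on each `P`.
  have key (P Q : X) (g : transporter P.1 Q.1) : ∃ m : L.Mor P Q, L.π m = F.homConj g ∧
      L.comp m (ι Q) = L.comp (ι P) (L.δ T ⟨g.1, trivial⟩) := by
    apply L.exists_lift
    intro x
    apply Subtype.ext
    rw [hι, π_comp_apply, π_δ, homConj_apply]
    simp only [Subgroup.coe_mul, Subgroup.coe_inv, hι]
  choose δ hδπ hδ using key
  refine ⟨fun {P Q} => δ P Q, fun P Q R g h => ?_, hδπ, fun P a => ?_⟩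
  · apply L.comp_right_cancel (g := ι R)
    rw [hδ, L.assoc, hδ, ← L.assoc, hδ, L.assoc, ← L.δ_mul]
    rfl
  · apply L.comp_right_cancel (g := ι P)
    rw [hδ, L.δ_comp]
    congr 2
    exact Subtype.ext (hι P a).symm

/-- The linking system determined by a prelinking system. -/
noncomputable def toLinkingSystem (hXne : X.Nonempty) (hX : F.IsClosedFamily X) :
    F.LinkingSystem X :=
  have h := (L.exists_transporter_extension hXne hX).choose_spec
  { Mor := L.Mor
    id := fun P => L.δ P 1
    comp := L.comp
    id_comp := L.one_comp
    comp_id := L.comp_one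
    assoc := L.assoc
    π := L.π
    π_id := L.π_δ_one
    π_comp := L.π_comp
    δ := (L.exists_transporter_extension hXne hX).choose
    δ_one := fun P => h.2.2 P 1
    δ_mul := h.1 _ _ _
    π_surjective := L.π_surjective
    free := fun f z hz hf => L.free f z hz (by rwa [h.2.2] at hf)
    π_eq_iff := fun {P Q} f f' => by
      refine ⟨fun hf => ?_, ?_⟩
      · obtain ⟨z, hz, rfl⟩ := L.exists_of_π_eq f f' hf
        exact ⟨z, hz, by rw [h.2.2]⟩
      · rintro ⟨z, hz, rfl⟩
        rw [h.2.2]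
        exact (L.π_center_comp f hz).symm
    π_δ := h.2.1 _ _
    δ_comp := fun f a => by
      rw [h.2.2, h.2.2]
      exact L.δ_comp f a }

theorem toLinkingSystem_δSelf (hXne : X.Nonempty) (hX : F.IsClosedFamily X) (P : X) (a : P.1) :
    (L.toLinkingSystem hXne hX).δSelf P a = L.δ P a :=
  (L.exists_transporter_extension hXne hX).choose_spec.2.2 P a

end PreLinkingSystem

/-! ### Twists -/

section Twist

variable {hX : F.IsClosedFamily X} {L L' L'' : F.LinkingSystem X}

/-- A map between morphism sets which commutes with `π` and with the action of `P`. -/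
structure IsEquivariant {P Q : X} (θ : L.Mor P Q → L'.Mor P Q) : Prop where
  π (f) : L'.π (θ f) = L.π f
  δSelf_comp (a : P.1) (f) : θ (L.comp (L.δSelf P a) f) = L'.comp (L'.δSelf P a) (θ f)

theorem IsEquivariant.δCenter_comp {P Q : X} {θ : L.Mor P Q → L'.Mor P Q}
    (h : IsEquivariant θ) (x : ZAt hX P) (f : L.Mor P Q) :
    θ (L.comp (L.δCenter hX P x) f) = L'.comp (L'.δCenter hX P x) (θ f) :=
  h.δSelf_comp _ f

include hX in
-- Over each morphism of `F`, the map `θ` is an equivariant map between two torsors under `Z(P)`.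
theorem IsEquivariant.bijective {P Q : X} {θ : L.Mor P Q → L'.Mor P Q} (h : IsEquivariant θ) :
    Function.Bijective θ := by
  constructor
  · intro f f' hf
    obtain ⟨x, rfl⟩ := L.exists_δCenter_comp hX
      (show L.π f = L.π f' by rw [← h.π, ← h.π, hf])
    rw [h.δCenter_comp] at hf
    have : (0 : ZAt hX P) = x := L'.δCenter_comp_injective hX (f := θ f) (by
      rw [← hf, L'.δCenter_zero, L'.id_comp])
    rw [← this, L.δCenter_zero, L.id_comp]
  · intro g
    obtain ⟨f, hf⟩ := L.π_surjective (L'.π g)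
    obtain ⟨x, rfl⟩ := L'.exists_δCenter_comp hX (show L'.π (θ f) = L'.π g by rw [h.π, hf])
    exact ⟨_, h.δCenter_comp x f⟩

theorem IsEquivariant.orbitMor {P Q : X} {θ : L.Mor P Q → L'.Mor P Q} (h : IsEquivariant θ)
    (f : L.Mor P Q) : L'.orbitMor hX (θ f) = L.orbitMor hX f :=
  congrArg (fun φ => F.orbitClass (P := hX.toOrbit P) (Q := hX.toOrbit Q) φ) (h.π f)

theorem isTwist_iff (z : Cochain₂ (centerFunctor hX)) : IsTwist hX z L L' ↔
    ∃ θ : ∀ P Q : X, L.Mor P Q → L'.Mor P Q, (∀ P Q, IsEquivariant (θ P Q)) ∧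
      ∀ (P Q R : X) (f : L.Mor P Q) (g : L.Mor Q R), θ P R (L.comp f g) =
        L'.comp (L'.δCenter hX P (z (hX.toOrbit P) (hX.toOrbit Q) (hX.toOrbit R)
          (L.orbitMor hX f) (L.orbitMor hX g))) (L'.comp (θ P Q f) (θ Q R g)) :=
  ⟨fun ⟨θ, h1, h2, h3⟩ => ⟨θ, fun P Q => ⟨h1 P Q, h2 P Q⟩, h3⟩,
    fun ⟨θ, h, h3⟩ => ⟨θ, fun P Q => (h P Q).π, fun P Q => (h P Q).δSelf_comp, h3⟩⟩

theorem LinkingSystem.Iso.isTwist_zero (hX : F.IsClosedFamily X) (h : L.Iso L') :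
    IsTwist hX 0 L L' := by
  obtain ⟨Ψ, -, h2, h3, h4⟩ := h
  refine (isTwist_iff 0).mpr ⟨fun P Q => Ψ P Q, fun P Q => ⟨h3 P Q, fun a f => ?_⟩,
    fun P Q R f g => ?_⟩
  · dsimp only
    rw [h2, LinkingSystem.δSelf, h4]
    rfl
  · dsimp only
    rw [h2]
    exact ((congrArg (fun k => L'.comp k _) (L'.δCenter_zero hX P)).trans (L'.id_comp _)).symm

theorem IsTwist.trans {z z' : Cochain₂ (centerFunctor hX)} (h : IsTwist hX z L L')
    (h' : IsTwist hX z' L' L'') : IsTwist hX (z + z') L L'' := by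
  obtain ⟨θ, hθ, h2⟩ := (isTwist_iff z).mp h
  obtain ⟨θ', hθ', h2'⟩ := (isTwist_iff z').mp h'
  refine (isTwist_iff (z + z')).mpr ⟨fun P Q f => θ' P Q (θ P Q f), fun P Q =>
    ⟨fun f => by rw [(hθ' P Q).π, (hθ P Q).π],
     fun a f => by dsimp only; rw [(hθ P Q).δSelf_comp, (hθ' P Q).δSelf_comp]⟩, fun P Q R f g => ?_⟩
  dsimp only
  rw [h2, (hθ' P R).δCenter_comp, h2', (hθ P Q).orbitMor, (hθ Q R).orbitMor,
    L''.δCenter_add_assoc]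
  rfl

theorem IsTwist.symm {z : Cochain₂ (centerFunctor hX)} (h : IsTwist hX z L L') :
    IsTwist hX (-z) L' L := by
  obtain ⟨θ, hθ, h2⟩ := (isTwist_iff z).mp h
  choose η hη using fun (P Q : X) => Function.bijective_iff_has_inverse.mp
    ((hθ P Q).bijective (hX := hX))
  have hη' (P Q : X) : IsEquivariant (η P Q) := by
    constructor
    · intro f
      rw [← (hθ P Q).π, (hη P Q).2]
    · intro a f
      apply ((hθ P Q).bijective (hX := hX)).1
      rw [(hη P Q).2, (hθ P Q).δSelf_comp, (hη P Q).2]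
  refine (isTwist_iff (-z)).mpr ⟨η, hη', fun P Q R f g => ?_⟩
  apply ((hθ P R).bijective (hX := hX)).1
  rw [(hη P R).2, (hθ P R).δCenter_comp, h2, (hη P Q).2, (hη Q R).2, (hη' P Q).orbitMor,
    (hη' Q R).orbitMor, L'.δCenter_add_assoc]
  simp only [Pi.neg_apply, neg_add_cancel]
  rw [L'.δCenter_zero, L'.id_comp]

/-- Rescaling every morphism by the inverse of `c` of its orbit class changes the composition by the
coboundary of `c`. -/
theorem isTwist_d₁ (c : Cochain₁ (centerFunctor hX)) (L : F.LinkingSystem X) :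
    IsTwist hX (d₁ _ c) L L := by
  refine (isTwist_iff _).mpr ⟨fun P Q f => L.comp (L.δCenter hX P (-c _ _ (L.orbitMor hX f))) f,
    fun P Q => ⟨fun f => L.π_δCenter_comp hX _ f, fun a f => ?_⟩, fun P Q R f g => ?_⟩
  · dsimp only
    rw [L.orbitMor_δSelf_comp, L.δSelf_comp_δCenter]
  · dsimp only
    rw [L.δCenter_comp_comp, L.δCenter_add_assoc, L.orbitMor_comp]
    congr 2
    simp only [d₁, AddMonoidHom.coe_mk, ZeroHom.coe_mk, map_neg]
    abel

/-- The maps in a twist commute with the action of `Q` on morphisms to `Q`. -/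
theorem IsEquivariant.comp_δSelf {z : Cochain₂ (centerFunctor hX)}
    {θ : ∀ P Q : X, L.Mor P Q → L'.Mor P Q} (hθ : ∀ P Q, IsEquivariant (θ P Q))
    (h : ∀ (P Q R : X) (f : L.Mor P Q) (g : L.Mor Q R), θ P R (L.comp f g) =
        L'.comp (L'.δCenter hX P (z (hX.toOrbit P) (hX.toOrbit Q) (hX.toOrbit R)
          (L.orbitMor hX f) (L.orbitMor hX g))) (L'.comp (θ P Q f) (θ Q R g)))
    {P Q : X} (f : L.Mor P Q) (q : Q.1) :
    θ P Q (L.comp f (L.δSelf Q q)) = L'.comp (θ P Q f) (L'.δSelf Q q) := by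
  have h1 : θ Q Q (L.δSelf Q q) = L'.comp (θ Q Q (L.id Q)) (L'.δSelf Q q) := by
    have h2 := (hθ Q Q).δSelf_comp q (L.id Q)
    rw [L.comp_id, L'.δSelf_comp, (hθ Q Q).π, L.π_id] at h2
    exact h2
  have h3 : L.orbitMor hX (L.δSelf Q q) = L.orbitMor hX (L.id Q) := by
    have := L.orbitMor_comp_δSelf hX (L.id Q) q
    rwa [L.id_comp] at this
  -- The factors `z([f], [δ(q)])` and `z([f], [id])` coincide, since `δ(q)` and the identity have
  -- the same orbit class; so the formula for `q` is the one for the identity followed by `δ'(q)`.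
  rw [h, h1, h3, ← L'.assoc (θ P Q f), ← L'.assoc, ← h, L.comp_id]

/-- Expanding `θ` on the two bracketings of a triple composite gives the same morphism with two
central coefficients. Freeness equates them. -/
theorem IsTwist.mem_cocycle₂ {z : Cochain₂ (centerFunctor hX)} (h : IsTwist hX z L L') :
    z ∈ Cocycle₂ (centerFunctor hX) := by
  obtain ⟨θ, hθ, h2⟩ := (isTwist_iff z).mp h
  refine cochain₃_ext fun P Q R T m n k => ?_
  obtain ⟨f, rfl⟩ := L.orbitMor_surjective hX m
  obtain ⟨g, rfl⟩ := L.orbitMor_surjective hX n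
  obtain ⟨e, rfl⟩ := L.orbitMor_surjective hX k
  have h3 := congrArg (θ P T) (L.assoc f g e)
  rw [h2, h2 P Q R, h2 P Q T, h2 Q R T, L'.assoc, L'.assoc, L'.δCenter_add_assoc,
    L'.comp_δCenter_assoc, L'.δCenter_add_assoc, L.orbitMor_comp, L.orbitMor_comp,
    (hθ P Q).orbitMor] at h3
  have h4 := L'.δCenter_comp_injective hX h3
  simp only [d₂, AddMonoidHom.coe_mk, ZeroHom.coe_mk, Pi.zero_apply]
  rw [← sub_eq_zero] at h4
  rw [← neg_eq_zero, ← h4]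
  abel

/-- A self-twist multiplies each morphism by a central element `c`. This element depends only on the
orbit class, so it is a 1-cochain, and the twist formula says that `-c` has coboundary `z`. -/
theorem IsTwist.exists_d₁_eq {z : Cochain₂ (centerFunctor hX)} (h : IsTwist hX z L L) :
    ∃ c, d₁ _ c = z := by
  obtain ⟨θ, hθ, h2⟩ := (isTwist_iff z).mp h
  choose s hs using fun (P Q : X) (m : hX.toOrbit P ⟶ hX.toOrbit Q) => L.orbitMor_surjective hX m
  choose c hc using fun (P Q : X) (f : L.Mor P Q) =>
    L.exists_δCenter_comp hX ((hθ P Q).π f).symm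
  -- Both `θ` and multiplication by `c` on the left commute with the action of `Q` on the right.
  have hcs (P Q : X) (f : L.Mor P Q) : c P Q f = c P Q (s P Q (L.orbitMor hX f)) := by
    obtain ⟨q, hq⟩ := L.exists_comp_δSelf hX (hs P Q (L.orbitMor hX f))
    have h3 := IsEquivariant.comp_δSelf hθ h2 (s P Q (L.orbitMor hX f)) q
    rw [← hq, hc, hc P Q (s P Q _), L.assoc, ← hq] at h3
    exact L.δCenter_comp_injective hX h3
  refine ⟨-extend₁ hX fun P Q m => c P Q (s P Q m), cochain₂_ext fun P Q R m n => ?_⟩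
  obtain ⟨f, rfl⟩ := L.orbitMor_surjective hX m
  obtain ⟨g, rfl⟩ := L.orbitMor_surjective hX n
  have h3 := h2 P Q R f g
  rw [hc, hc P Q f, hc Q R g] at h3
  rw [L.δCenter_comp_comp, L.δCenter_add_assoc] at h3
  have h4 := L.δCenter_comp_injective hX h3
  simp only [d₁, AddMonoidHom.coe_mk, ZeroHom.coe_mk, Pi.neg_apply, extend₁_apply, map_neg]
  rw [← L.orbitMor_comp, ← hcs, ← hcs, ← hcs, h4]
  abel

/-- Any two linking systems have the same orbit sets and the same stabilizers. An equivariant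
matching therefore exists, and its failure to be a functor is central. -/
theorem exists_isTwist (hX : F.IsClosedFamily X) (L L' : F.LinkingSystem X) :
    ∃ z : Cochain₂ (centerFunctor hX), IsTwist hX z L L' := by
  choose s hs using fun (P Q : X) (m : hX.toOrbit P ⟶ hX.toOrbit Q) => L.orbitMor_surjective hX m
  choose s' hs' using fun (P Q : X) (m : hX.toOrbit P ⟶ hX.toOrbit Q) =>
    L'.π_surjective (L.π (s P Q m))
  choose q hq using fun (P Q : X) (f : L.Mor P Q) =>
    L.exists_comp_δSelf hX (hs P Q (L.orbitMor hX f))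
  -- Send each representative `s` to a morphism of `L'` over the same morphism of `F`, and extend
  -- along the free action of `Q`.
  obtain ⟨θ, hθπ, hθδ⟩ : ∃ θ : ∀ P Q : X, L.Mor P Q → L'.Mor P Q,
      (∀ P Q f, L'.π (θ P Q f) = L.π f) ∧
      ∀ (P Q : X) (f : L.Mor P Q) (r : Q.1),
        θ P Q (L.comp f (L.δSelf Q r)) = L'.comp (θ P Q f) (L'.δSelf Q r) := by
    refine ⟨fun P Q f => L'.comp (s' P Q (L.orbitMor hX f)) (L'.δSelf Q (q P Q f)),
      fun P Q f => ?_, fun P Q f r => ?_⟩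
    · apply Subtype.ext
      ext1 x
      conv_rhs => rw [hq P Q f]
      rw [L.π_comp_apply, L'.π_comp_apply, hs', L.π_δSelf_apply, L'.π_δSelf_apply]
    · have h1 : q P Q (L.comp f (L.δSelf Q r)) = r * q P Q f := by
        apply L.comp_δSelf_injective hX (s P Q (L.orbitMor hX f))
        rw [L.δSelf_mul, ← L.assoc, ← hq P Q f]
        conv_rhs => rw [hq P Q (L.comp f (L.δSelf Q r))]
        rw [L.orbitMor_comp_δSelf]
      dsimp only
      rw [h1, L.orbitMor_comp_δSelf, L'.δSelf_mul, L'.assoc]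
  have hθ (P Q : X) : IsEquivariant (θ P Q) := by
    refine ⟨hθπ P Q, fun a f => ?_⟩
    rw [L.δSelf_comp, L'.δSelf_comp, hθδ, hθπ]
  choose w hw using fun (P Q R : X) (f : L.Mor P Q) (g : L.Mor Q R) =>
    L'.exists_δCenter_comp hX (show L'.π (L'.comp (θ P Q f) (θ Q R g)) =
        L'.π (θ P R (L.comp f g)) by
      rw [L'.π_comp, hθπ, hθπ, hθπ, L.π_comp])
  -- The discrepancy `w` is unchanged when `f` is modified by `Q` or `g` by `R`, so it descends to
  -- the orbit category.
  have hw₁ (P Q R : X) (f : L.Mor P Q) (g : L.Mor Q R) (r : Q.1) :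
      w P Q R (L.comp f (L.δSelf Q r)) g = w P Q R f g := by
    have h1 := hw P Q R (L.comp f (L.δSelf Q r)) g
    rw [L.assoc, L.δSelf_comp, ← L.assoc, hθδ, hθδ, L'.assoc (θ P Q f), L'.δSelf_comp, hθπ,
      hw P Q R f g, L'.assoc, L'.assoc] at h1
    exact (L'.δCenter_comp_injective hX h1).symm
  have hw₂ (P Q R : X) (f : L.Mor P Q) (g : L.Mor Q R) (r : R.1) :
      w P Q R f (L.comp g (L.δSelf R r)) = w P Q R f g := by
    have h1 := hw P Q R f (L.comp g (L.δSelf R r))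
    rw [← L.assoc, hθδ, hθδ, hw P Q R f g, L'.assoc, L'.assoc] at h1
    exact (L'.δCenter_comp_injective hX h1).symm
  refine ⟨extend₂ hX fun P Q R m n => w P Q R (s P Q m) (s Q R n),
    (isTwist_iff _).mpr ⟨θ, hθ, fun P Q R f g => ?_⟩⟩
  rw [extend₂_apply, hw P Q R f g]
  congr 2
  conv_lhs => rw [hq P Q f, hq Q R g]
  rw [hw₁, hw₂]

end Twist

end FusionSystem

namespace FusionSystem

open HigherLimits

variable {S : Type u} [Group S] {F : FusionSystem S} {X : Set (Subgroup S)}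

/-! ### Twisting by a given cocycle, and triviality of twists by zero -/

section TwistExistence

variable {hX : F.IsClosedFamily X} {L L' L'' : F.LinkingSystem X}

/-- The cocycle identity for `(id, id, f)`. Cocycles are not normalized, so this and its right-hand
analogue are needed to find the identities of the twisted composition. -/
theorem cocycle₂_id_left {z : Cochain₂ (centerFunctor hX)} (hz : z ∈ Cocycle₂ (centerFunctor hX))
    {P Q : F.OrbitCategory F.centric} (f : P ⟶ Q) : z P P Q (𝟙 P) f = z P P P (𝟙 P) (𝟙 P) := by
  have h : d₂ (centerFunctor hX) z P P P Q (𝟙 P) (𝟙 P) f = 0 := by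
    rw [show d₂ (centerFunctor hX) z = 0 from hz]
    rfl
  simp only [d₂, AddMonoidHom.coe_mk, ZeroHom.coe_mk, Category.id_comp, op_id,
    CategoryTheory.Functor.map_id, AddCommGrpCat.hom_id, AddMonoidHom.id_apply, sub_self,
    zero_add] at h
  exact sub_eq_zero.mp h

theorem cocycle₂_id_right {z : Cochain₂ (centerFunctor hX)} (hz : z ∈ Cocycle₂ (centerFunctor hX))
    {P Q : F.OrbitCategory F.centric} (f : P ⟶ Q) :
    z P Q Q f (𝟙 Q) = (centerFunctor hX).map f.op (z Q Q Q (𝟙 Q) (𝟙 Q)) := by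
  have h : d₂ (centerFunctor hX) z P Q Q Q f (𝟙 Q) (𝟙 Q) = 0 := by
    rw [show d₂ (centerFunctor hX) z = 0 from hz]
    rfl
  simp only [d₂, AddMonoidHom.coe_mk, ZeroHom.coe_mk, Category.comp_id, sub_add_cancel] at h
  exact (sub_eq_zero.mp h).symm

namespace LinkingSystem

variable (L) (z : Cochain₂ (centerFunctor hX))

/-- The composition of `L` twisted by the inverse of a `2`-cochain. -/
noncomputable def twistComp {P Q R : X} (f : L.Mor P Q) (g : L.Mor Q R) : L.Mor P R :=
  L.comp (L.δCenter hX P (-z _ _ _ (L.orbitMor hX f) (L.orbitMor hX g))) (L.comp f g)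

/-- The elements of `P` as automorphisms for the twisted composition. -/
noncomputable def twistδ (P : X) (a : P.1) : L.Mor P P :=
  L.δSelf P (a * zval (z (hX.toOrbit P) (hX.toOrbit P) (hX.toOrbit P) (𝟙 _) (𝟙 _) : ZAt hX P))

theorem twistδ_eq (P : X) (a : P.1) : L.twistδ z P a =
    L.comp (L.δCenter hX P (z _ _ _ (𝟙 _) (𝟙 _))) (L.δSelf P a) :=
  L.δSelf_mul P _ _

theorem orbitMor_twistδ (P : X) (a : P.1) : L.orbitMor hX (L.twistδ z P a) = 𝟙 _ :=
  L.orbitMor_δSelf hX P _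

theorem orbitMor_twistComp {P Q R : X} (f : L.Mor P Q) (g : L.Mor Q R) :
    L.orbitMor hX (L.twistComp z f g) = L.orbitMor hX f ≫ L.orbitMor hX g :=
  (L.orbitMor_δSelf_comp hX _ _).trans (L.orbitMor_comp hX f g)

variable {z} (hz : z ∈ Cocycle₂ (centerFunctor hX))
include hz

/-- The shift by `z(id, id)` in `twistδ` cancels the twist, so `P` acts on morphisms out of it
exactly as in `L`. Freeness and the description of the fibres of `π` are thus inherited. -/
theorem twistδ_twistComp {P Q : X} (a : P.1) (f : L.Mor P Q) :
    L.twistComp z (L.twistδ z P a) f = L.comp (L.δSelf P a) f := by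
  rw [twistComp, orbitMor_twistδ, cocycle₂_id_left hz, twistδ_eq, L.assoc, L.δCenter_add_assoc,
    neg_add_cancel, L.δCenter_zero, L.id_comp]

theorem twistComp_twistδ {P Q : X} (f : L.Mor P Q) (a : Q.1) :
    L.twistComp z f (L.twistδ z Q a) = L.comp f (L.δSelf Q a) := by
  rw [twistComp, orbitMor_twistδ, cocycle₂_id_right hz, twistδ_eq, L.comp_δCenter_assoc,
    L.δCenter_add_assoc, neg_add_cancel, L.δCenter_zero, L.id_comp]

theorem twistComp_assoc {P Q R T : X} (f : L.Mor P Q) (g : L.Mor Q R) (h : L.Mor R T) :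
    L.twistComp z (L.twistComp z f g) h = L.twistComp z f (L.twistComp z g h) := by
  have h1 : d₂ (centerFunctor hX) z _ _ _ _ (L.orbitMor hX f) (L.orbitMor hX g)
      (L.orbitMor hX h) = 0 := by
    rw [show d₂ (centerFunctor hX) z = 0 from hz]
    rfl
  rw [twistComp, orbitMor_twistComp, twistComp, L.assoc, L.δCenter_add_assoc, twistComp,
    orbitMor_twistComp, twistComp, L.comp_δCenter_assoc, L.δCenter_add_assoc, L.assoc]
  congr 2
  simp only [d₂, AddMonoidHom.coe_mk, ZeroHom.coe_mk] at h1
  rw [← sub_eq_zero, map_neg, ← h1]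
  abel

/-- The linking system `L` with composition twisted by the inverse of a `2`-cocycle. -/
noncomputable def twist : F.PreLinkingSystem X where
  Mor := L.Mor
  comp := L.twistComp z
  assoc := L.twistComp_assoc hz
  π := L.π
  π_comp f g := (L.π_δCenter_comp hX _ _).trans (L.π_comp f g)
  δ := L.twistδ z
  δ_mul P a b := by
    rw [L.twistδ_twistComp hz, twistδ, twistδ, ← L.δSelf_mul, mul_assoc, mul_assoc, zval_comm]
  one_comp f := by rw [L.twistδ_twistComp hz, L.δSelf_one, L.id_comp]
  comp_one f := by rw [L.twistComp_twistδ hz, L.δSelf_one, L.comp_id]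
  π_surjective := L.π_surjective
  free f a ha h := L.free f a ha ((L.twistδ_twistComp hz a f).symm.trans h)
  exists_of_π_eq f f' h := by
    obtain ⟨a, ha, h'⟩ := (L.π_eq_iff f f').mp h
    exact ⟨a, ha, h'.trans (L.twistδ_twistComp hz a f).symm⟩
  π_δ P a x := by
    rw [twistδ, L.π_δSelf_apply, mul_assoc a, ← zval_comm]
    group
  δ_comp f a := by rw [L.twistδ_twistComp hz, L.twistComp_twistδ hz, L.δSelf_comp]

end LinkingSystem

/-- Keep the morphism sets and let `θ` be the identity. The new composition carries `-z`, so the old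
one is the new one multiplied by `z`. -/
theorem exists_isTwist_left (hXne : X.Nonempty) (L : F.LinkingSystem X)
    {z : Cochain₂ (centerFunctor hX)} (hz : z ∈ Cocycle₂ (centerFunctor hX)) :
    ∃ L' : F.LinkingSystem X, IsTwist hX z L L' := by
  refine ⟨(L.twist hz).toLinkingSystem hXne hX, (isTwist_iff z).mpr
    ⟨fun P Q f => f, fun P Q => ⟨fun f => rfl, fun a f => ?_⟩, fun P Q R f g => ?_⟩⟩
  · rw [PreLinkingSystem.toLinkingSystem_δSelf]
    exact (L.twistδ_twistComp hz a f).symm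
  · rw [LinkingSystem.δCenter, PreLinkingSystem.toLinkingSystem_δSelf]
    refine Eq.trans ?_ (L.twistδ_twistComp hz _ (L.twistComp z f g)).symm
    change _ = L.comp (L.δCenter hX P _) (L.comp (L.δCenter hX P _) _)
    rw [L.δCenter_add_assoc, add_neg_cancel, L.δCenter_zero, L.id_comp]

/-- A twist by the trivial cocycle is an isomorphism, up to a natural transformation. -/
theorem IsTwist.iso (hXne : X.Nonempty) (h : IsTwist hX 0 L L') : L.Iso L' := by
  classical
  obtain ⟨θ, hθ, h2⟩ := (isTwist_iff 0).mp h
  have hcomp {P Q R : X} (f : L.Mor P Q) (g : L.Mor Q R) :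
      θ P R (L.comp f g) = L'.comp (θ P Q f) (θ Q R g) := by
    rw [h2]
    exact (congrArg (fun k => L'.comp k _) (L'.δCenter_zero hX P)).trans (L'.id_comp _)
  have hid (P : X) : θ P P (L.id P) = L'.id P := by
    apply L'.comp_right_cancel (g := θ P P (L.id P))
    rw [← hcomp, L.id_comp, L'.id_comp]
  obtain ⟨P₀, hP₀⟩ := hXne
  let T : X := ⟨⊤, hX.overgroup_mem P₀ hP₀ ⊤ le_top⟩
  have hT (P : X) : (1 : S) ∈ transporter P.1 T.1 := fun _ _ => trivial
  have hπ (P : X) : L'.π (θ P T (L.δ ⟨1, hT P⟩)) = L'.π (L'.δ ⟨1, hT P⟩) := by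
    rw [(hθ P T).π, L.π_δ, L'.π_δ]
  -- The element `w P` measures how far `θ` is from preserving the inclusion of `P` in `S`; it is
  -- zero for `S` itself.
  choose w hw using fun P => L'.exists_δCenter_comp hX (hπ P)
  have hwT : w T = 0 := by
    apply L'.δCenter_comp_injective hX (f := θ T T (L.δ ⟨1, hT T⟩))
    rw [← hw, L'.δCenter_zero, L'.id_comp]
    exact (L'.δ_one T).trans ((hid T).symm.trans (congrArg _ (L.δ_one T).symm))
  -- Conjugating `θ` by these central automorphisms keeps it a functor over `F` and makes it
  -- preserve inclusions into `S`.
  let Ψ (P Q : X) (f : L.Mor P Q) : L'.Mor P Q :=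
    L'.comp (L'.δCenter hX P (w P)) (L'.comp (θ P Q f) (L'.δCenter hX Q (-w Q)))
  have hΨ (P Q : X) : IsEquivariant (Ψ P Q) := by
    constructor
    · intro f
      simp only [Ψ]
      rw [L'.comp_δCenter, L'.π_δCenter_comp, L'.π_δCenter_comp, (hθ P Q).π]
    · intro a f
      simp only [Ψ]
      rw [(hθ P Q).δSelf_comp, L'.assoc, L'.δSelf_comp_δCenter]
  have hΨ_id (P : X) : Ψ P P (L.id P) = L'.id P := by
    simp only [Ψ]
    rw [hid, L'.id_comp, L'.δCenter_add, add_neg_cancel, L'.δCenter_zero]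
  have hΨ_comp (P Q R : X) (f : L.Mor P Q) (g : L.Mor Q R) :
      Ψ P R (L.comp f g) = L'.comp (Ψ P Q f) (Ψ Q R g) := by
    simp only [Ψ]
    rw [hcomp, L'.assoc, L'.assoc, L'.assoc, L'.δCenter_add_assoc, neg_add_cancel,
      L'.δCenter_zero, L'.id_comp]
  have hΨ_incl (P : X) : Ψ P T (L.δ ⟨1, hT P⟩) = L'.δ ⟨1, hT P⟩ := by
    simp only [Ψ]
    rw [hwT, neg_zero, L'.δCenter_zero, L'.comp_id, ← hw]
  have hΨ_T (g : T.1) : Ψ T T (L.δSelf T g) = L'.δSelf T g := by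
    rw [← L.comp_id (L.δSelf T g), (hΨ T T).δSelf_comp, hΨ_id, L'.comp_id]
  -- A transporter morphism is determined by its composite with an inclusion into `S`, which is
  -- expressed by an inclusion and an automorphism of `S`; `Ψ` respects both.
  have key (L : F.LinkingSystem X) {P Q : X} (g : transporter P.1 Q.1) :
      L.comp (L.δ g) (L.δ ⟨1, hT Q⟩) = L.comp (L.δ ⟨1, hT P⟩) (L.δSelf T ⟨g.1, trivial⟩) := by
    rw [LinkingSystem.δSelf, ← L.δ_mul, ← L.δ_mul]
    congr 1
    apply Subtype.ext
    simp
  refine ⟨fun P Q => Equiv.ofBijective (Ψ P Q) ((hΨ P Q).bijective (hX := hX)), hΨ_id, hΨ_comp,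
    fun P Q => (hΨ P Q).π, fun P Q g => ?_⟩
  apply L'.comp_right_cancel (g := L'.δ ⟨1, hT Q⟩)
  rw [Equiv.ofBijective_apply, key L', ← hΨ_incl, ← hΨ_comp, key L, hΨ_comp, hΨ_incl, hΨ_T]

end TwistExistence

/-! ### The action of second cohomology -/

section Action

variable {hX : F.IsClosedFamily X}

theorem class₂_eq_iff {z z' : Cocycle₂ (centerFunctor hX)} :
    class₂ z = class₂ z' ↔ ∃ c, d₁ _ c = z'.1 - z.1 := by
  rw [class₂, class₂, QuotientAddGroup.eq, AddSubgroup.mem_addSubgroupOf, neg_add_eq_sub]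
  rfl

theorem toClass_eq_iff {L L' : F.LinkingSystem X} : L.toClass = L'.toClass ↔ L.Iso L' :=
  ⟨fun h => Quotient.exact h, fun h => Quotient.sound h⟩

theorem exists_toClass_eq (x : F.LinkingClasses X) : ∃ L : F.LinkingSystem X, L.toClass = x :=
  Quotient.exists_rep x

theorem toClass_eq_iff_isTwist (hXne : X.Nonempty) {L L' : F.LinkingSystem X} :
    L.toClass = L'.toClass ↔ IsTwist hX 0 L L' :=
  toClass_eq_iff.trans ⟨fun h => h.isTwist_zero hX, fun h => h.iso hXne⟩

/-- Twists depend only on the cohomology class and the isomorphism classes. -/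
theorem IsTwist.congr (hXne : X.Nonempty) {z z' : Cocycle₂ (centerFunctor hX)}
    {L₁ L₁' L₂ L₂' : F.LinkingSystem X} (hz : class₂ z = class₂ z')
    (h₁ : L₁.toClass = L₁'.toClass) (h₂ : L₂.toClass = L₂'.toClass)
    (h : IsTwist hX z.1 L₁ L₂) : IsTwist hX z'.1 L₁' L₂' := by
  obtain ⟨c, hc⟩ := class₂_eq_iff.mp hz
  have := (((toClass_eq_iff_isTwist hXne).mp h₁.symm).trans ((isTwist_d₁ c L₁).trans h)).trans
    ((toClass_eq_iff_isTwist hXne).mp h₂)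
  rwa [hc, sub_add_cancel, zero_add, add_zero] at this

/-- Following one twist by the inverse of the other is a self-twist of `L`, hence a coboundary. This
is freeness of the action. -/
theorem IsTwist.class₂_eq {z z' : Cocycle₂ (centerFunctor hX)} {L L' : F.LinkingSystem X}
    (h : IsTwist hX z.1 L L') (h' : IsTwist hX z'.1 L L') : class₂ z = class₂ z' := by
  obtain ⟨c, hc⟩ := (h'.trans h.symm).exists_d₁_eq
  exact class₂_eq_iff.mpr ⟨c, by rw [hc, sub_eq_add_neg]⟩

theorem IsTwist.toClass_eq (hXne : X.Nonempty) {z : Cochain₂ (centerFunctor hX)}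
    {L L' L'' : F.LinkingSystem X} (h : IsTwist hX z L L') (h' : IsTwist hX z L L'') :
    L'.toClass = L''.toClass := by
  have := h.symm.trans h'
  rw [neg_add_cancel] at this
  exact (toClass_eq_iff_isTwist hXne).mpr this

/-- The second cohomology group of the bar complex acts on the isomorphism classes of linking
systems, freely and transitively. -/
theorem exists_addAction (hXne : X.Nonempty) {H : Type*} [AddCommGroup H]
    (e : BarH₂ (centerFunctor hX) ≃+ H) :
    ∃ act : AddAction H (F.LinkingClasses X),
      (∀ (z : Cocycle₂ (centerFunctor hX)) (L L' : F.LinkingSystem X),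
        act.vadd (e (class₂ z)) L.toClass = L'.toClass ↔ IsTwist hX z.1 L L') ∧
      (∀ (a : H) (x : F.LinkingClasses X), act.vadd a x = x → a = 0) ∧
      (∀ x y : F.LinkingClasses X, ∃ a : H, act.vadd a x = y) := by
  have hrep (a : H) : ∃ z : Cocycle₂ (centerFunctor hX), e (class₂ z) = a := by
    obtain ⟨z, hz⟩ := QuotientAddGroup.mk_surjective (e.symm a)
    exact ⟨z, by rw [class₂, hz, e.apply_symm_apply]⟩
  -- The image of a class is characterized for all representatives at once, so the action axioms can
  -- be checked on any representatives.
  have hex (a : H) (x : F.LinkingClasses X) : ∃ y : F.LinkingClasses X,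
      ∀ (z : Cocycle₂ (centerFunctor hX)) (L L' : F.LinkingSystem X), e (class₂ z) = a →
        L.toClass = x → (y = L'.toClass ↔ IsTwist hX z.1 L L') := by
    obtain ⟨z₀, rfl⟩ := hrep a
    obtain ⟨L₀, rfl⟩ := exists_toClass_eq x
    obtain ⟨L₁, h₁⟩ := exists_isTwist_left hXne L₀ z₀.2
    refine ⟨L₁.toClass, fun z L L' hz hL => ⟨fun h => ?_, fun h => ?_⟩⟩
    · exact h₁.congr hXne (e.injective hz).symm hL.symm h
    · exact h₁.toClass_eq hXne (h.congr hXne (e.injective hz) hL rfl)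
  choose v hv using hex
  have hv' (z : Cocycle₂ (centerFunctor hX)) (L L' : F.LinkingSystem X) :
      v (e (class₂ z)) L.toClass = L'.toClass ↔ IsTwist hX z.1 L L' := hv _ _ z L L' rfl rfl
  refine ⟨{ vadd := v, zero_vadd := fun x => ?_, add_vadd := fun a b x => ?_ }, hv', fun a x => ?_,
    fun x y => ?_⟩
  · obtain ⟨z, rfl⟩ := hrep a
    obtain ⟨z', rfl⟩ := hrep b
    obtain ⟨L, rfl⟩ := exists_toClass_eq x
    obtain ⟨L', h⟩ := exists_isTwist_left hXne L z'.2
    obtain ⟨L'', h'⟩ := exists_isTwist_left hXne L' z.2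
    change v _ _ = v _ (v _ _)
    rw [(hv' z' L L').mpr h, (hv' z L' L'').mpr h']
    refine (hv _ _ (z + z') L L'' (map_add e (class₂ z) (class₂ z')) rfl).mpr ?_
    rw [add_comm]
    exact h.trans h'
  · obtain ⟨L, rfl⟩ := exists_toClass_eq x
    refine (hv 0 _ 0 L L ?_ rfl).mpr ((toClass_eq_iff_isTwist hXne).mp rfl)
    exact map_zero e
  · intro (h : v a x = x)
    obtain ⟨z, rfl⟩ := hrep a
    obtain ⟨L, rfl⟩ := exists_toClass_eq x
    have h1 := ((hv' z L L).mp h).class₂_eq (z' := 0) ((toClass_eq_iff_isTwist hXne).mp rfl)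
    rw [h1]
    exact map_zero e
  · obtain ⟨L, rfl⟩ := exists_toClass_eq x
    obtain ⟨L', rfl⟩ := exists_toClass_eq y
    obtain ⟨z, hz⟩ := exists_isTwist hX L L'
    exact ⟨e (class₂ ⟨z, hz.mem_cocycle₂⟩), (hv' ⟨z, hz.mem_cocycle₂⟩ L L').mpr hz⟩

end Action

end FusionSystem

namespace FusionSystem

open HigherLimits

variable {S : Type u} [Group S] {F : FusionSystem S} {X : Set (Subgroup S)}

/-! ### The obstruction class -/

section Obstruction

/-- `σ` chooses representatives of the morphisms of the orbit category, and `t` elements which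
compare the composites of the representatives with the representatives of composites. -/
structure IsLift (σ : ∀ P Q : F.OrbitCategory F.centric, (P ⟶ Q) → F.Hom P.obj Q.obj)
    (t : ∀ P Q R : F.OrbitCategory F.centric, (P ⟶ Q) → (Q ⟶ R) → R.obj) : Prop where
  orbitClass (P Q f) : F.orbitClass (σ P Q f) = f
  comm (P Q R f g) (x : P.obj) :
    (σ Q R g).1 ((σ P Q f).1 x) * t P Q R f g = t P Q R f g * (σ P R (f ≫ g)).1 x

/-- `u` measures the failure of associativity for the choices `σ` and `t`. -/
def IsDefect (hX : F.IsClosedFamily X)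
    (σ : ∀ P Q : F.OrbitCategory F.centric, (P ⟶ Q) → F.Hom P.obj Q.obj)
    (t : ∀ P Q R : F.OrbitCategory F.centric, (P ⟶ Q) → (Q ⟶ R) → R.obj)
    (u : Cochain₃ (centerFunctor hX)) : Prop :=
  ∀ P Q R T f g h, P.obj ∈ X →
    (σ R T h).1 (t P Q R f g) * t P R T (f ≫ g) h =
      t Q R T g h * t P Q T f (g ≫ h) * (σ P T (f ≫ g ≫ h)).1 (centerVal (u P Q R T f g h))

theorem isObstructionCochain_iff {hX : F.IsClosedFamily X} {u : Cochain₃ (centerFunctor hX)} :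
    IsObstructionCochain hX u ↔ ∃ σ t, IsLift σ t ∧ IsDefect hX σ t u :=
  ⟨fun ⟨σ, t, h1, h2, h3⟩ =>
    ⟨σ, t, ⟨h1, fun P Q R f g x => by rw [h2, inv_mul_cancel_right]⟩, h3⟩,
   fun ⟨σ, t, h, h3⟩ =>
    ⟨σ, t, h.orbitClass, fun P Q R f g x => eq_mul_inv_of_mul_eq (h.comm P Q R f g x), h3⟩⟩

variable {hX : F.IsClosedFamily X}
  {σ : ∀ P Q : F.OrbitCategory F.centric, (P ⟶ Q) → F.Hom P.obj Q.obj}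
  {t : ∀ P Q R : F.OrbitCategory F.centric, (P ⟶ Q) → (Q ⟶ R) → R.obj}
  {u u' : Cochain₃ (centerFunctor hX)}

theorem exists_conj_of_orbitClass_eq {P Q : F.OrbitCategory F.centric} {φ ψ : F.Hom P.obj Q.obj}
    (h : (F.orbitClass φ : P ⟶ Q) = F.orbitClass ψ) :
    ∃ q : Q.obj, ∀ x, ψ.1 x * q = q * φ.1 x := by
  obtain ⟨q, hq⟩ := Quotient.exact h
  exact ⟨q, fun x => by rw [hq, inv_mul_cancel_right]⟩

/-- Two elements which conjugate a morphism from a centric `P` in the same way differ by an element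
of `Z(P)`. -/
theorem exists_center_of_comm {P Q : Subgroup S} (hP : P ∈ F.centric) (φ : F.Hom P Q) {a b : Q}
    (ψ : P → Q) (ha : ∀ x, ψ x * a = a * φ.1 x) (hb : ∀ x, ψ x * b = b * φ.1 x) :
    ∃ z ∈ Subgroup.center P, a = b * φ.1 z := by
  obtain ⟨z, hz, h⟩ := exists_center_of_centralizes hP φ (b⁻¹ * a) (fun x => by
    have h1 : b⁻¹ * ψ x = φ.1 x * b⁻¹ := by
      rw [eq_mul_inv_iff_mul_eq, mul_assoc, hb, inv_mul_cancel_left]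
    rw [mul_assoc, ← ha, ← mul_assoc, h1, mul_assoc])
  exact ⟨z, hz, by rw [h, mul_inv_cancel_left]⟩

/-- Both sides of the associativity equation conjugate `σ(hgf)` to `σ(h) ∘ σ(g) ∘ σ(f)`. As `P` is
centric, they differ by the image of an element of `Z(P)`. -/
theorem IsLift.exists_isDefect (h : IsLift σ t) (hX : F.IsClosedFamily X) :
    ∃ u, IsDefect hX σ t u := by
  have key (P Q R T f g k) (hP : P.obj ∈ X) : ∃ u : (centerFunctor hX).obj (op P),
      (σ R T k).1 (t P Q R f g) * t P R T (f ≫ g) k =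
        t Q R T g k * t P Q T f (g ≫ k) * (σ P T (f ≫ g ≫ k)).1 (centerVal u) := by
    obtain ⟨z, hz, hz'⟩ := exists_center_of_comm P.mem (σ P T (f ≫ g ≫ k))
      (a := (σ R T k).1 (t P Q R f g) * t P R T (f ≫ g) k)
      (b := t Q R T g k * t P Q T f (g ≫ k))
      (fun x => (σ R T k).1 ((σ Q R g).1 ((σ P Q f).1 x)))
      (fun x => by
        have h1 := h.comm P R T (f ≫ g) k x
        rw [Category.assoc] at h1
        rw [← mul_assoc, ← map_mul, h.comm, map_mul, mul_assoc, h1, mul_assoc])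
      (fun x => by
        rw [← mul_assoc, h.comm, mul_assoc, h.comm, mul_assoc])
    obtain ⟨u, rfl⟩ := exists_centerVal_eq (hX := hX) hP hz
    exact ⟨u, hz'⟩
  classical
  choose u hu using key
  exact ⟨fun P Q R T f g k => if hP : P.obj ∈ X then u P Q R T f g k hP else 0,
    fun P Q R T f g k hP => by dsimp only; rw [dif_pos hP]; exact hu P Q R T f g k hP⟩

/-! ### Uniqueness of the defect and its cocycle identity -/

theorem IsDefect.unique (h : IsDefect hX σ t u) (h' : IsDefect hX σ t u') : u = u' := by
  refine cochain₃_ext fun P Q R T f g k => centerVal_ext fun hP => ?_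
  exact F.injective (σ _ _ _).2
    (mul_left_cancel ((h _ _ _ _ f g k hP).symm.trans (h' _ _ _ _ f g k hP)))

/-- The nonabelian pentagon for four arrows `f, g, k, l`. The equations `h₁` to `h₅` are the five
defect equations, `h₁` being the image under `σ(l)` of the one for `(f, g, k)`; `h₆` to `h₈` move
factors past elements `t`. The `sᵢ` are the images of the five terms of the coboundary. -/
theorem cocycle_aux {G : Type*} [Group G] {H A B C D E M N p q r v w s₁ s₂ s₃ s₄ s₅ : G}
    (h₁ : H * A = C * D * E) (h₂ : D * B = M * N * s₂) (h₃ : C * M = p * q * r)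
    (h₄ : A * B = p * w * s₄) (h₅ : v * w = q * N * s₅) (h₆ : E * B = B * s₁)
    (h₇ : H * p = p * v) (h₈ : r * N = N * s₃) : s₃ * s₂ * s₁ = s₅ * s₄ := by
  apply mul_left_cancel (a := p * q * N)
  calc p * q * N * (s₃ * s₂ * s₁) = p * q * (N * s₃) * s₂ * s₁ := by simp only [mul_assoc]
    _ = (p * q * r) * N * s₂ * s₁ := by rw [← h₈]; simp only [mul_assoc]
    _ = C * (M * N * s₂) * s₁ := by rw [← h₃]; simp only [mul_assoc]
    _ = C * D * (B * s₁) := by rw [← h₂]; simp only [mul_assoc]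
    _ = (C * D * E) * B := by rw [← h₆]; simp only [mul_assoc]
    _ = H * (A * B) := by rw [← h₁, mul_assoc]
    _ = (H * p) * w * s₄ := by rw [h₄]; simp only [mul_assoc]
    _ = p * (v * w) * s₄ := by rw [h₇]; simp only [mul_assoc]
    _ = p * q * N * (s₅ * s₄) := by rw [h₅]; simp only [mul_assoc]

theorem IsLift.comm_centerVal (h : IsLift σ t) {P Q R : F.OrbitCategory F.centric}
    (hP : P.obj ∈ X) (f : P ⟶ Q) (g : Q ⟶ R) (x : (centerFunctor hX).obj (op Q)) :
    (σ Q R g).1 (centerVal x) * t P Q R f g =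
      t P Q R f g * (σ P R (f ≫ g)).1 (centerVal ((centerFunctor hX).map f.op x)) := by
  rw [← h.comm, apply_centerVal_map' hP (h.orbitClass P Q f)]

theorem IsDefect.mem_cocycle₃ (h : IsLift σ t) (hu : IsDefect hX σ t u) :
    u ∈ Cocycle₃ (centerFunctor hX) := by
  funext P Q R T U f g k l
  refine centerVal_ext fun hP => ?_
  have hQ := mem_of_orbitHom f hX hP
  have h₁ := congrArg (σ T U l).1 (hu P Q R T f g k hP)
  have h₂ := hu P Q T U f (g ≫ k) l hP
  have h₃ := hu Q R T U g k l hQ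
  have h₄ := hu P R T U (f ≫ g) k l hP
  have h₅ := hu P Q R U f g (k ≫ l) hP
  have h₆ := h.comm P T U (f ≫ g ≫ k) l (centerVal (u P Q R T f g k))
  have h₇ := h.comm R T U k l (t P Q R f g)
  have h₈ := h.comm_centerVal (hX := hX) hP f (g ≫ k ≫ l) (u Q R T U g k l)
  simp only [Category.assoc, map_mul] at h₁ h₂ h₃ h₄ h₅ h₆ h₇ h₈
  have h₉ := cocycle_aux h₁ h₂ h₃ h₄ h₅ h₆ h₇ h₈
  rw [← map_mul, ← map_mul, ← map_mul] at h₉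
  have h₁₀ := F.injective (σ _ _ _).2 h₉
  rw [← centerVal_add, ← centerVal_add, ← centerVal_add] at h₁₀
  have h₁₁ := centerVal_ext (hX := hX) fun _ => h₁₀
  congr 1
  simp only [d₃, AddMonoidHom.coe_mk, ZeroHom.coe_mk, Pi.zero_apply]
  rw [← sub_eq_zero] at h₁₁
  rw [← h₁₁]
  abel

/-! ### Dependence of the defect on the choices -/

theorem mul_aux_left {G : Type*} [Group G] {a b c d e m n s : G} (h₁ : a * b = c * d * e)
    (h₂ : m * b = b * s) : a * m * (b * n) = c * d * (e * s * n) := by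
  calc a * m * (b * n) = a * (m * b) * n := by simp only [mul_assoc]
    _ = (a * b) * s * n := by rw [h₂]; simp only [mul_assoc]
    _ = c * d * (e * s * n) := by rw [h₁]; simp only [mul_assoc]

theorem mul_aux_right {G : Type*} [Group G] {c d n s v w : G} (h : w * d = d * s) :
    c * w * (d * n) * v = c * d * (s * n * v) := by
  calc c * w * (d * n) * v = c * (w * d) * n * v := by simp only [mul_assoc]
    _ = c * d * (s * n * v) := by rw [h]; simp only [mul_assoc]

/-- Changing the elements `t` by a `2`-cochain. -/
theorem IsDefect.sub_d₂ (h : IsLift σ t) (hu : IsDefect hX σ t u)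
    {t' : ∀ P Q R : F.OrbitCategory F.centric, (P ⟶ Q) → (Q ⟶ R) → R.obj}
    (c : Cochain₂ (centerFunctor hX))
    (ht : ∀ P Q R f g, P.obj ∈ X →
      t' P Q R f g = t P Q R f g * (σ P R (f ≫ g)).1 (centerVal (c P Q R f g))) :
    IsDefect hX σ t' (u - d₂ _ c) := by
  intro P Q R T f g k hP
  have hQ := mem_of_orbitHom f hX hP
  have h₁ := hu P Q R T f g k hP
  have h₂ := h.comm P R T (f ≫ g) k (centerVal (c P Q R f g))
  have h₃ := h.comm_centerVal (hX := hX) hP f (g ≫ k) (c Q R T g k)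
  rw [ht _ _ _ _ _ hP, ht _ _ _ _ _ hP, ht _ _ _ _ _ hQ, ht _ _ _ _ _ hP]
  simp only [Category.assoc, map_mul] at h₁ h₂ h₃ ⊢
  have hL : (σ R T k).1 (t P Q R f g) * (σ R T k).1 ((σ P R (f ≫ g)).1 (centerVal (c P Q R f g))) *
      (t P R T (f ≫ g) k * (σ P T (f ≫ g ≫ k)).1 (centerVal (c P R T (f ≫ g) k))) =
      t Q R T g k * t P Q T f (g ≫ k) * (σ P T (f ≫ g ≫ k)).1 (centerVal
        (u P Q R T f g k + c P Q R f g + c P R T (f ≫ g) k)) := by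
    rw [centerVal_add, centerVal_add, map_mul, map_mul]
    exact mul_aux_left h₁ h₂
  have hR : t Q R T g k * (σ Q T (g ≫ k)).1 (centerVal (c Q R T g k)) *
      (t P Q T f (g ≫ k) * (σ P T (f ≫ g ≫ k)).1 (centerVal (c P Q T f (g ≫ k)))) *
      (σ P T (f ≫ g ≫ k)).1 (centerVal ((u - d₂ (centerFunctor hX) c) P Q R T f g k)) =
      t Q R T g k * t P Q T f (g ≫ k) * (σ P T (f ≫ g ≫ k)).1 (centerVal
        ((centerFunctor hX).map f.op (c Q R T g k) + c P Q T f (g ≫ k) +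
          (u - d₂ (centerFunctor hX) c) P Q R T f g k)) := by
    rw [centerVal_add, centerVal_add, map_mul, map_mul]
    exact mul_aux_right h₃
  rw [hL, hR]
  congr 3
  simp only [d₂, AddMonoidHom.coe_mk, ZeroHom.coe_mk, Pi.sub_apply]
  abel

/-- Changing the representatives `σ`. -/
theorem IsLift.change (h : IsLift σ t) (hu : IsDefect hX σ t u)
    {σ' : ∀ P Q : F.OrbitCategory F.centric, (P ⟶ Q) → F.Hom P.obj Q.obj}
    (hσ' : ∀ P Q f, F.orbitClass (σ' P Q f) = f) :
    ∃ t', IsLift σ' t' ∧ IsDefect hX σ' t' u := by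
  choose q hq using fun P Q f =>
    exists_conj_of_orbitClass_eq ((h.orbitClass P Q f).trans (hσ' P Q f).symm)
  have hq' (P Q f x) : (σ' P Q f).1 x = q P Q f * (σ P Q f).1 x * (q P Q f)⁻¹ :=
    eq_mul_inv_of_mul_eq (hq P Q f x)
  -- This `t'` is `t` transported along the conjugations `q` from `σ` to `σ'`. In the associativity
  -- equation all the new factors cancel, so the defect is literally the same `u`.
  refine ⟨fun P Q R f g =>
    q Q R g * (σ Q R g).1 (q P Q f) * t P Q R f g * (q P R (f ≫ g))⁻¹,
    ⟨hσ', fun P Q R f g x => ?_⟩, fun P Q R T f g k hP => ?_⟩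
  · have h₁ := h.comm P Q R f g x
    simp only [hq', map_mul, map_inv, mul_assoc, inv_mul_cancel_left]
    simp only [← mul_assoc] at h₁ ⊢
    rw [mul_assoc _ _ (t P Q R f g), h₁]
    simp only [mul_assoc]
  · have h₁ := hu P Q R T f g k hP
    have h₂ := h.comm Q R T g k (q P Q f)
    simp only [hq', map_mul, map_inv, mul_assoc, inv_mul_cancel_left, Category.assoc]
    rw [← mul_assoc (t Q R T g k) ((σ Q T (g ≫ k)).1 _), ← h₂,
      ← mul_assoc ((σ R T k).1 (t P Q R f g)), h₁]
    simp only [mul_assoc]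

/-- Transport `t` to the representatives `σ'` without changing `u`. Two choices of comparison
elements for the same `σ'` then differ by central values, whose coboundary accounts for the
difference of the defects. -/
theorem IsLift.exists_d₂_eq
    {σ' : ∀ P Q : F.OrbitCategory F.centric, (P ⟶ Q) → F.Hom P.obj Q.obj}
    {t' : ∀ P Q R : F.OrbitCategory F.centric, (P ⟶ Q) → (Q ⟶ R) → R.obj}
    (h : IsLift σ t) (hu : IsDefect hX σ t u) (h' : IsLift σ' t') (hu' : IsDefect hX σ' t' u') :
    ∃ c, d₂ _ c = u - u' := by
  obtain ⟨t'', h'', hu''⟩ := h.change hu h'.orbitClass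
  have key (P Q R f g) : ∃ c : (centerFunctor hX).obj (op P), P.obj ∈ X →
      t' P Q R f g = t'' P Q R f g * (σ' P R (f ≫ g)).1 (centerVal c) := by
    by_cases hP : P.obj ∈ X
    · obtain ⟨z, hz, hz'⟩ := exists_center_of_comm P.mem (σ' P R (f ≫ g)) _
        (h'.comm P Q R f g) (h''.comm P Q R f g)
      obtain ⟨c, rfl⟩ := exists_centerVal_eq (hX := hX) hP hz
      exact ⟨c, fun _ => hz'⟩
    · exact ⟨0, fun h => absurd h hP⟩
  choose c hc using key
  refine ⟨c, ?_⟩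
  rw [hu'.unique (hu''.sub_d₂ h'' c hc), sub_sub_cancel]

theorem IsLift.comm_of_center (h : IsLift σ t) (c : Cochain₂ (centerFunctor hX)) :
    IsLift σ (fun P Q R f g => t P Q R f g * (σ P R (f ≫ g)).1 (centerVal (c P Q R f g))) := by
  refine ⟨h.orbitClass, fun P Q R f g x => ?_⟩
  rw [← mul_assoc, h.comm, mul_assoc, mul_assoc, ← map_mul, ← map_mul,
    Subgroup.mem_center_iff.mp (centerVal_mem_center _)]

theorem exists_isLift : ∃ (σ : ∀ P Q : F.OrbitCategory F.centric, (P ⟶ Q) → F.Hom P.obj Q.obj)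
    (t : ∀ P Q R : F.OrbitCategory F.centric, (P ⟶ Q) → (Q ⟶ R) → R.obj), IsLift σ t := by
  have h (P Q : F.OrbitCategory F.centric) (f : P ⟶ Q) :
      ∃ φ : F.Hom P.obj Q.obj, F.orbitClass φ = f := Quotient.exists_rep f
  choose σ hσ using h
  choose t ht using fun P Q R f g => exists_conj_of_orbitClass_eq (P := P) (Q := R)
    (φ := σ P R (f ≫ g)) (ψ := F.homComp (σ P Q f) (σ Q R g))
    (by rw [orbitClass_homComp, hσ, hσ, hσ])
  exact ⟨σ, t, hσ, ht⟩

theorem exists_isObstructionCochain (hX : F.IsClosedFamily X) : ∃ u, IsObstructionCochain hX u := by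
  obtain ⟨σ, t, h⟩ := exists_isLift (F := F)
  obtain ⟨u, hu⟩ := h.exists_isDefect hX
  exact ⟨u, isObstructionCochain_iff.mpr ⟨σ, t, h, hu⟩⟩

theorem IsObstructionCochain.mem_cocycle₃ (h : IsObstructionCochain hX u) :
    u ∈ Cocycle₃ (centerFunctor hX) := by
  obtain ⟨σ, t, h, hu⟩ := isObstructionCochain_iff.mp h
  exact IsDefect.mem_cocycle₃ h hu

theorem IsObstructionCochain.class₃_eq (h : IsObstructionCochain hX u)
    (h' : IsObstructionCochain hX u') :
    class₃ ⟨u, h.mem_cocycle₃⟩ = class₃ ⟨u', h'.mem_cocycle₃⟩ := by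
  obtain ⟨σ, t, h, hu⟩ := isObstructionCochain_iff.mp h
  obtain ⟨σ', t', h', hu'⟩ := isObstructionCochain_iff.mp h'
  obtain ⟨c, hc⟩ := h'.exists_d₂_eq hu' h hu
  rw [class₃, class₃, QuotientAddGroup.eq, AddSubgroup.mem_addSubgroupOf, neg_add_eq_sub]
  exact ⟨c, hc⟩

/-- If the class of an obstruction cochain vanishes, so does some obstruction cochain. -/
theorem IsObstructionCochain.zero (h : IsObstructionCochain hX u)
    (h0 : class₃ ⟨u, h.mem_cocycle₃⟩ = 0) : IsObstructionCochain hX 0 := by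
  rw [class₃, QuotientAddGroup.eq_zero_iff, AddSubgroup.mem_addSubgroupOf] at h0
  obtain ⟨c, hc⟩ := h0
  obtain ⟨σ, t, h, hu⟩ := isObstructionCochain_iff.mp h
  have := hu.sub_d₂ h c (fun _ _ _ _ _ _ => rfl)
  rw [hc, sub_self] at this
  exact isObstructionCochain_iff.mpr ⟨σ, _, h.comm_of_center c, this⟩

/-! ### Linking systems from vanishing obstruction cochains -/

section Construction

variable (h : IsLift σ t) (h0 : IsDefect hX σ t 0)

theorem IsDefect.zero_eq (h0 : IsDefect hX σ t 0) {P Q R T : F.OrbitCategory F.centric}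
    (hP : P.obj ∈ X) (f : P ⟶ Q) (g : Q ⟶ R) (k : R ⟶ T) :
    (σ R T k).1 (t P Q R f g) * t P R T (f ≫ g) k = t Q R T g k * t P Q T f (g ≫ k) := by
  rw [h0 _ _ _ _ _ _ _ hP, show centerVal ((0 : Cochain₃ (centerFunctor hX)) P Q R T f g k) = 1
    from rfl, map_one, mul_one]

include h0 in
-- Strict associativity on `(id, id, f)`, after cancellation. Neither `σ(id)` nor `t(id, id)` is
-- normalized, so the unit laws must be extracted in this way.
theorem IsDefect.t_id_left {P Q : F.OrbitCategory F.centric} (hP : P.obj ∈ X) (f : P ⟶ Q) :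
    t P P Q (𝟙 P) f = (σ P Q f).1 (t P P P (𝟙 P) (𝟙 P)) := by
  have := h0.zero_eq hP (𝟙 P) (𝟙 P) f
  simp only [Category.id_comp] at this
  exact (mul_right_cancel this).symm

include h in
theorem IsLift.σ_id (P : F.OrbitCategory F.centric) (x : P.obj) :
    (σ P P (𝟙 P)).1 x * t P P P (𝟙 P) (𝟙 P) = t P P P (𝟙 P) (𝟙 P) * x := by
  obtain ⟨q, hq⟩ := exists_conj_of_orbitClass_eq (P := P) (φ := F.homId P.obj)
    (h.orbitClass P P (𝟙 P)).symm
  have hq' (y : P.obj) : (σ P P (𝟙 P)).1 y = q * y * q⁻¹ := eq_mul_inv_of_mul_eq (hq y)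
  -- Since `σ(id)` is inner it is surjective, so the comparison for `(id, id)`, known on its image,
  -- holds on all of `P`.
  obtain ⟨y, rfl⟩ : ∃ y, (σ P P (𝟙 P)).1 y = x := ⟨q⁻¹ * x * q, by rw [hq']; group⟩
  have := h.comm P P P (𝟙 P) (𝟙 P) y
  simpa only [Category.id_comp] using this

include h h0 in
theorem IsDefect.t_id_right {P Q : F.OrbitCategory F.centric} (hP : P.obj ∈ X) (f : P ⟶ Q) :
    t P Q Q f (𝟙 Q) = t Q Q Q (𝟙 Q) (𝟙 Q) := by
  have h1 := h0.zero_eq hP f (𝟙 Q) (𝟙 Q)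
  simp only [Category.comp_id] at h1
  have h2 := mul_right_cancel h1
  have h3 := h.σ_id Q (t P Q Q f (𝟙 Q))
  rw [h2] at h3
  exact (mul_left_cancel h3).symm

end Construction

/-- Choices of representatives `σ` of the orbit morphisms between members of `X`, and of elements
`t`, for which the multiplication on the sets `Q × Mor(P, Q)` is associative. -/
structure AssocLift (hX : F.IsClosedFamily X) where
  /-- the representatives -/
  σ {P Q : X} (f : hX.toOrbit P ⟶ hX.toOrbit Q) : F.Hom P.1 Q.1
  /-- the elements comparing composites -/
  t {P Q R : X} (f : hX.toOrbit P ⟶ hX.toOrbit Q) (g : hX.toOrbit Q ⟶ hX.toOrbit R) : R.1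
  exists_conj {P Q : X} (φ : F.Hom P.1 Q.1) : ∃ f, ∃ q : Q.1, ∀ x, φ.1 x = q * (σ f).1 x * q⁻¹
  eq_of_conj {P Q : X} (f f' : hX.toOrbit P ⟶ hX.toOrbit Q) (q : Q.1) :
    (∀ x, (σ f').1 x = q * (σ f).1 x * q⁻¹) → f = f'
  comm {P Q R : X} (f : hX.toOrbit P ⟶ hX.toOrbit Q) (g : hX.toOrbit Q ⟶ hX.toOrbit R) (x : P.1) :
    (σ g).1 ((σ f).1 x) * t f g = t f g * (σ (f ≫ g)).1 x
  assoc {P Q R T : X} (f : hX.toOrbit P ⟶ hX.toOrbit Q) (g : hX.toOrbit Q ⟶ hX.toOrbit R)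
    (k : hX.toOrbit R ⟶ hX.toOrbit T) :
    (σ k).1 (t f g) * t (f ≫ g) k = t g k * t f (g ≫ k)
  σ_id (P : X) (x : P.1) : (σ (𝟙 (hX.toOrbit P))).1 x * t (𝟙 (hX.toOrbit P)) (𝟙 (hX.toOrbit P)) =
    t (𝟙 (hX.toOrbit P)) (𝟙 (hX.toOrbit P)) * x
  t_id_left {P Q : X} (f : hX.toOrbit P ⟶ hX.toOrbit Q) :
    t (𝟙 (hX.toOrbit P)) f = (σ f).1 (t (𝟙 (hX.toOrbit P)) (𝟙 (hX.toOrbit P)))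
  t_id_right {P Q : X} (f : hX.toOrbit P ⟶ hX.toOrbit Q) :
    t f (𝟙 (hX.toOrbit Q)) = t (𝟙 (hX.toOrbit Q)) (𝟙 (hX.toOrbit Q))

/-- The restriction to `X` of choices with vanishing defect. -/
def IsDefect.toAssocLift (h0 : IsDefect hX σ t 0) (h : IsLift σ t) : AssocLift hX where
  σ f := σ _ _ f
  t f g := t _ _ _ f g
  exists_conj {P Q} φ := by
    obtain ⟨q, hq⟩ := exists_conj_of_orbitClass_eq
      (h.orbitClass (hX.toOrbit P) (hX.toOrbit Q) (F.orbitClass φ))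
    exact ⟨F.orbitClass (P := hX.toOrbit P) (Q := hX.toOrbit Q) φ, q,
      fun x => eq_mul_inv_of_mul_eq (hq x)⟩
  eq_of_conj {P Q} f f' q hq := by
    rw [← h.orbitClass _ _ f, ← h.orbitClass _ _ f']
    exact Quotient.sound ⟨q, hq⟩
  comm f g x := h.comm _ _ _ f g x
  assoc {P Q R T} f g k := h0.zero_eq P.2 f g k
  σ_id P x := h.σ_id (hX.toOrbit P) x
  t_id_left {P Q} f := h0.t_id_left P.2 f
  t_id_right {P Q} f := IsDefect.t_id_right h h0 P.2 f

namespace AssocLift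

variable (A : AssocLift hX)

theorem σ_id_apply (P : X) (x : P.1) : (A.σ (𝟙 (hX.toOrbit P))).1 x =
    A.t (𝟙 (hX.toOrbit P)) (𝟙 (hX.toOrbit P)) * x *
      (A.t (𝟙 (hX.toOrbit P)) (𝟙 (hX.toOrbit P)))⁻¹ :=
  eq_mul_inv_of_mul_eq (A.σ_id P x)

/-- The morphism `c_q ∘ σ(f)`. -/
def conjσ {P Q : X} (q : Q.1) (f : hX.toOrbit P ⟶ hX.toOrbit Q) : F.Hom P.1 Q.1 :=
  F.homComp (A.σ f) (F.homConj ⟨q.1, mem_transporter_self q.2⟩)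

theorem conjσ_apply {P Q : X} (q : Q.1) (f : hX.toOrbit P ⟶ hX.toOrbit Q) (x : P.1) :
    (A.conjσ q f).1 x = q * (A.σ f).1 x * q⁻¹ := rfl

/-- The automorphism of `P` given by `a ∈ P`. -/
def δ (P : X) (a : P.1) : P.1 × (hX.toOrbit P ⟶ hX.toOrbit P) :=
  (a * (A.t (𝟙 (hX.toOrbit P)) (𝟙 (hX.toOrbit P)))⁻¹, 𝟙 (hX.toOrbit P))

/-- The composition on the sets `Q × Mor(P, Q)`. -/
def comp {P Q R : X} (a : Q.1 × (hX.toOrbit P ⟶ hX.toOrbit Q))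
    (b : R.1 × (hX.toOrbit Q ⟶ hX.toOrbit R)) : R.1 × (hX.toOrbit P ⟶ hX.toOrbit R) :=
  (b.1 * (A.σ b.2).1 a.1 * A.t a.2 b.2, a.2 ≫ b.2)

theorem δ_comp {P Q : X} (a : P.1) (b : Q.1 × (hX.toOrbit P ⟶ hX.toOrbit Q)) :
    A.comp (A.δ P a) b = (b.1 * (A.σ b.2).1 a, b.2) := by
  refine Prod.ext ?_ (Category.id_comp _)
  simp only [comp, δ]
  rw [A.t_id_left b.2, map_mul, map_inv, mul_assoc, inv_mul_cancel_right]

theorem comp_δ {P Q : X} (b : Q.1 × (hX.toOrbit P ⟶ hX.toOrbit Q)) (a : Q.1) :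
    A.comp b (A.δ Q a) = (a * b.1, b.2) := by
  refine Prod.ext ?_ (Category.comp_id _)
  simp only [comp, δ]
  rw [A.t_id_right b.2, A.σ_id_apply]
  group

/-- Moving `t` past the image of the first factor by `comm` reduces this to the strict associativity
of `t`. -/
theorem comp_assoc {P Q R T : X} (a : Q.1 × (hX.toOrbit P ⟶ hX.toOrbit Q))
    (b : R.1 × (hX.toOrbit Q ⟶ hX.toOrbit R)) (c : T.1 × (hX.toOrbit R ⟶ hX.toOrbit T)) :
    A.comp (A.comp a b) c = A.comp a (A.comp b c) := by
  refine Prod.ext ?_ (Category.assoc _ _ _)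
  simp only [comp, map_mul, mul_assoc]
  rw [A.assoc, ← mul_assoc ((A.σ c.2).1 ((A.σ b.2).1 a.1)), A.comm]
  simp only [mul_assoc]

/-- The linking system with morphism sets `Q × Mor(P, Q)`. -/
def toPreLinkingSystem : F.PreLinkingSystem X where
  Mor P Q := Q.1 × (hX.toOrbit P ⟶ hX.toOrbit Q)
  comp := A.comp
  assoc := A.comp_assoc
  π a := A.conjσ a.1 a.2
  π_comp {P Q R} a b := by
    apply Subtype.ext
    ext1 x
    change _ = (A.conjσ b.1 b.2).1 ((A.conjσ a.1 a.2).1 x)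
    have h1 : (A.σ b.2).1 ((A.σ a.2).1 x) =
        A.t a.2 b.2 * (A.σ (a.2 ≫ b.2)).1 x * (A.t a.2 b.2)⁻¹ :=
      eq_mul_inv_of_mul_eq (A.comm a.2 b.2 x)
    simp only [conjσ_apply, comp, map_mul, map_inv, h1]
    group
  δ := A.δ
  δ_mul P a b := by
    rw [A.comp_δ]
    simp only [δ, mul_assoc]
  one_comp f := by rw [A.δ_comp, map_one, mul_one]
  comp_one f := by rw [A.comp_δ, one_mul]
  π_surjective φ := by
    obtain ⟨f, q, hq⟩ := A.exists_conj φ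
    refine ⟨(q, f), Subtype.ext ?_⟩
    ext1 x
    rw [hq, conjσ_apply]
  free {P Q} f z hz h := by
    rw [A.δ_comp] at h
    exact F.injective (A.σ f.2).2 ((mul_eq_left.mp (congrArg Prod.fst h)).trans (map_one _).symm)
  exists_of_π_eq {P Q} a b h := by
    obtain ⟨q, f⟩ := a
    obtain ⟨r, g⟩ := b
    have h' (x) : q * (A.σ f).1 x * q⁻¹ = r * (A.σ g).1 x * r⁻¹ :=
      congrArg (fun φ : F.Hom P.1 Q.1 => φ.1 x) h
    -- Equal images in `F` have equal orbit classes. The remaining quotient `q⁻¹ r` centralizes the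
    -- image of `σ(f)`, so it comes from `Z(P)`.
    obtain rfl : f = g := by
      refine A.eq_of_conj f g (r⁻¹ * q) fun x => ?_
      calc (A.σ g).1 x = r⁻¹ * (r * (A.σ g).1 x * r⁻¹) * r := by group
        _ = _ := by rw [← h']; group
    obtain ⟨z, hz, hz'⟩ := exists_center_of_centralizes (hX.centric P.2) (A.σ f) (q⁻¹ * r)
      fun x => by
        calc q⁻¹ * r * (A.σ f).1 x = q⁻¹ * (r * (A.σ f).1 x * r⁻¹) * r := by group
          _ = _ := by rw [← h']; group
    refine ⟨z, hz, ?_⟩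
    rw [A.δ_comp, hz', mul_inv_cancel_left]
  π_δ P a x := by
    simp only [δ, conjσ_apply, A.σ_id_apply]
    group
  δ_comp {P Q} f a := by
    rw [A.δ_comp, A.comp_δ, conjσ_apply, inv_mul_cancel_right]

end AssocLift

theorem IsObstructionCochain.nonempty_linkingClasses (hXne : X.Nonempty)
    (h : IsObstructionCochain hX 0) : Nonempty (F.LinkingClasses X) := by
  obtain ⟨σ, t, h, h0⟩ := isObstructionCochain_iff.mp h
  exact ⟨((h0.toAssocLift h).toPreLinkingSystem.toLinkingSystem hXne hX).toClass⟩

/-- The obstruction cochain vanishes for choices made in a linking system. -/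
theorem LinkingSystem.isObstructionCochain_zero (L : F.LinkingSystem X) :
    IsObstructionCochain hX 0 := by
  have hs (P Q : F.OrbitCategory F.centric) (hP : P.obj ∈ X) (hQ : Q.obj ∈ X) (f : P ⟶ Q) :
      ∃ s : L.Mor ⟨P.obj, hP⟩ ⟨Q.obj, hQ⟩, F.orbitClass (P := P) (Q := Q) (L.π s) = f :=
    L.orbitMor_surjective (P := ⟨P.obj, hP⟩) (Q := ⟨Q.obj, hQ⟩) hX f
  choose s hs using hs
  -- On chains in `X` the representatives are images of chosen morphisms of `L`; outside `X` any
  -- representatives will do, since no condition on `u` is imposed there.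
  have hσ (P Q : F.OrbitCategory F.centric) (f : P ⟶ Q) : ∃ φ : F.Hom P.obj Q.obj,
      F.orbitClass φ = f ∧ ∀ (hP : P.obj ∈ X) (hQ : Q.obj ∈ X),
        φ = L.π (s P Q hP hQ f) := by
    by_cases hP : P.obj ∈ X
    · have hQ := mem_of_orbitHom f hX hP
      exact ⟨L.π (s P Q hP hQ f), hs _ _ _ _ _, fun _ _ => rfl⟩
    · obtain ⟨φ, hφ⟩ := Quotient.exists_rep f
      exact ⟨φ, hφ, fun h => absurd h hP⟩
  choose σ hσ hσs using hσ
  -- For chains in `X`, `t` is read off in `L` itself, by comparing a composite of chosen morphisms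
  -- with the chosen morphism of the composite.
  have ht (P Q R : F.OrbitCategory F.centric) (f : P ⟶ Q) (g : Q ⟶ R) : ∃ t : R.obj,
      (∀ x, (σ Q R g).1 ((σ P Q f).1 x) * t = t * (σ P R (f ≫ g)).1 x) ∧
      ∀ (hP : P.obj ∈ X) (hQ : Q.obj ∈ X) (hR : R.obj ∈ X),
        L.comp (s P Q hP hQ f) (s Q R hQ hR g) =
          L.comp (s P R hP hR (f ≫ g)) (L.δSelf ⟨R.obj, hR⟩ t) := by
    by_cases hP : P.obj ∈ X
    · have hQ := mem_of_orbitHom f hX hP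
      have hR := mem_of_orbitHom g hX hQ
      obtain ⟨t, ht⟩ := L.exists_comp_δSelf hX (f := s P R hP hR (f ≫ g))
        (f' := L.comp (s P Q hP hQ f) (s Q R hQ hR g))
        (by
          refine (hs P R hP hR (f ≫ g)).trans ?_
          rw [LinkingSystem.orbitMor, L.π_comp]
          exact (congrArg₂ (fun a b => a ≫ b) (hs P Q hP hQ f) (hs Q R hQ hR g)).symm)
      refine ⟨t, fun x => ?_, fun _ _ _ => ht⟩
      rw [hσs P Q f hP hQ, hσs Q R g hQ hR, hσs P R (f ≫ g) hP hR]
      have h1 := L.π_comp_apply (s P Q hP hQ f) (s Q R hQ hR g) x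
      rw [ht, L.π_comp_apply, L.π_δSelf_apply] at h1
      exact (mul_inv_eq_iff_eq_mul.mp h1).symm
    · obtain ⟨t, ht⟩ := exists_conj_of_orbitClass_eq (P := P) (Q := R)
        (φ := σ P R (f ≫ g)) (ψ := F.homComp (σ P Q f) (σ Q R g))
        (by rw [orbitClass_homComp, hσ, hσ, hσ])
      exact ⟨t, ht, fun h => absurd h hP⟩
  choose t ht hts using ht
  refine isObstructionCochain_iff.mpr ⟨σ, t, ⟨hσ, ht⟩, fun P Q R T f g k hP => ?_⟩
  have hQ := mem_of_orbitHom f hX hP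
  have hR := mem_of_orbitHom g hX hQ
  have hT := mem_of_orbitHom k hX hR
  -- Associativity in `L` expresses both bracketings as one chosen morphism followed by an element
  -- of `T`; freeness of the action of `T` equates the two elements.
  have h1 := L.assoc (s P Q hP hQ f) (s Q R hQ hR g)
    (s R T hR hT k)
  rw [hts P Q R f g hP hQ hR, hts Q R T g k hQ hR hT, L.assoc, L.δSelf_comp, ← L.assoc, ← L.assoc,
    hts P R T (f ≫ g) k hP hR hT, hts P Q T f (g ≫ k) hP hQ hT, Category.assoc, L.assoc, L.assoc,
    ← L.δSelf_mul, ← L.δSelf_mul, ← hσs R T k hR hT] at h1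
  have h2 := L.comp_δSelf_injective hX _ h1
  rw [show centerVal ((0 : Cochain₃ (centerFunctor hX)) P Q R T f g k) = 1 from rfl, map_one,
    mul_one]
  exact h2

/-- A linking system provides the zero cochain as an obstruction cochain, and the class is
independent of choices, so `o = 0`. Conversely, a vanishing class lets `t` be corrected to strict
associativity. -/
theorem exists_obstruction_class (hXne : X.Nonempty) {H : Type*} [AddCommGroup H]
    (e : BarH₃ (centerFunctor hX) ≃+ H) :
    ∃ o : H, (∃ u, IsObstructionCochain hX u) ∧
      (∀ u, IsObstructionCochain hX u →
        ∃ hu : u ∈ Cocycle₃ (centerFunctor hX), e (class₃ ⟨u, hu⟩) = o) ∧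
      (Nonempty (F.LinkingClasses X) ↔ o = 0) := by
  obtain ⟨u₀, h₀⟩ := exists_isObstructionCochain hX
  refine ⟨e (class₃ ⟨u₀, h₀.mem_cocycle₃⟩), ⟨u₀, h₀⟩, fun u hu =>
    ⟨hu.mem_cocycle₃, congrArg e (hu.class₃_eq h₀)⟩, ?_, fun h => ?_⟩
  · rintro ⟨x⟩
    obtain ⟨L, -⟩ := exists_toClass_eq x
    rw [h₀.class₃_eq (L.isObstructionCochain_zero (hX := hX))]
    exact map_zero e
  · exact (h₀.zero ((map_eq_zero_iff e e.injective).mp h)).nonempty_linkingClasses hXne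

end Obstruction

end FusionSystem

/-! ### Assembly of the main theorem -/

theorem proposition1p5 {p : ℕ} [Fact p.Prime] {S : Type u} [Group S] [Finite S]
    (hS : IsPGroup p S) (F : FusionSystem S) (hF : F.IsSaturated p)
    (X : Set (Subgroup S)) (hXne : X.Nonempty) (hX : F.IsClosedFamily X) :
    -- `H²` and `H³` of the bar complex are the derived functors `lim²` and `lim³`
    Nonempty (BarH₂ (centerFunctor hX) ≃+ higherLim 2 (centerFunctor hX)) ∧
    Nonempty (BarH₃ (centerFunctor hX) ≃+ higherLim 3 (centerFunctor hX)) ∧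
    -- (a), under any such identification
    (∀ e₃ : BarH₃ (centerFunctor hX) ≃+ higherLim 3 (centerFunctor hX),
      ∃ o : higherLim 3 (centerFunctor hX),
        (∃ u, IsObstructionCochain hX u) ∧
        (∀ u, IsObstructionCochain hX u →
          ∃ hu : u ∈ Cocycle₃ (centerFunctor hX), e₃ (class₃ ⟨u, hu⟩) = o) ∧
        (Nonempty (F.LinkingClasses X) ↔ o = 0)) ∧
    (Subsingleton (higherLim 3 (centerFunctor hX)) → Nonempty (F.LinkingClasses X)) ∧
    -- (b), under any such identification
    (Nonempty (F.LinkingClasses X) →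
      (∀ e₂ : BarH₂ (centerFunctor hX) ≃+ higherLim 2 (centerFunctor hX),
        ∃ act : AddAction (higherLim 2 (centerFunctor hX)) (F.LinkingClasses X),
          (∀ (z : Cocycle₂ (centerFunctor hX)) (L L' : F.LinkingSystem X),
            act.vadd (e₂ (class₂ z)) L.toClass = L'.toClass ↔ IsTwist hX z.1 L L') ∧
          (∀ (a : higherLim 2 (centerFunctor hX)) (x : F.LinkingClasses X),
            act.vadd a x = x → a = 0) ∧
          (∀ x y : F.LinkingClasses X, ∃ a : higherLim 2 (centerFunctor hX),
            act.vadd a x = y)) ∧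
      Nonempty (higherLim 2 (centerFunctor hX) ≃ F.LinkingClasses X)) := by
  have e₂ := barH₂_equiv_higherLim (centerFunctor hX)
  have e₃ := barH₃_equiv_higherLim (centerFunctor hX)
  refine ⟨e₂, e₃, exists_obstruction_class hXne, fun _ => ?_, fun h =>
    ⟨exists_addAction hXne, ?_⟩⟩
  · obtain ⟨e⟩ := e₃
    obtain ⟨o, -, -, ho⟩ := exists_obstruction_class hXne e
    exact ho.mpr (Subsingleton.elim _ _)
  · obtain ⟨e⟩ := e₂
    obtain ⟨act, -, hfree, htrans⟩ := exists_addAction hXne e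
    obtain ⟨x⟩ := h
    -- The orbit map at a base point `x` is onto by transitivity and injective by freeness.
    refine ⟨Equiv.ofBijective (fun a => act.vadd a x) ⟨fun a b hab => ?_, htrans x⟩⟩
    have h1 : act.vadd (-b + a) x = x :=
      (act.add_vadd (-b) a x).trans ((congrArg (act.vadd (-b)) hab).trans
        ((act.add_vadd (-b) b x).symm.trans
          ((congrArg (fun c => act.vadd c x) (neg_add_cancel b)).trans (act.zero_vadd x))))
    exact (neg_add_eq_zero.mp (hfree _ _ h1)).symm
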